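/- **Lemma.** Let $(M,g_{ab})$ be a smooth four-dimensional spacetime with metric of signature $(+,-,-,-)$ and a spinor structure, i.e. a rank-two complex vector bundle $S$ of spinors with spin metric $\epsilon_{AB}$ such that $g_{ab}=\epsilon_{AB}\bar\epsilon_{A'B'}$, and let $\nabla_{AA'}$ be the (torsion-free, $\epsilon$-preserving) spin connection, which induces the Levi-Civita connection of $g$. Indices are raised and lowered by $\kappa^A=\epsilon^{AB}\kappa_B$, $\kappa_B=\kappa^A\epsilon_{AB}$, and all fields are smooth. Let $\kappa_{AB}=\kappa_{(AB)}$ be a Killing spinor, $\nabla_{(A|A'|}\kappa_{BC)}=0$, with $\kappa_{CD}\kappa^{CD}\neq 0$ everywhere, and let $\phi_{AB}=\phi_{(AB)}$ be a solution of the source-free Maxwell equation $\nabla^{B}{}_{A'}\phi_{AB}=0$. Define $$U_{AA'}=-\tfrac12\nabla_{AA'}\log(-\kappa_{CD}\kappa^{CD}),\qquad \Upsilon=\kappa^{AB}\phi_{AB},\qquad \Theta_{AB}=-2\kappa_{(A}{}^{C}\phi_{B)C},$$ $$\beta_{AA'}=\nabla^{B}{}_{A'}\Theta_{AB}+U^{B}{}_{A'}\Theta_{AB},$$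 where $\nabla\log f$ means $f^{-1}\nabla f$ (which is independent of the branch of the logarithm). Then $$\beta_{AA'}=-U_{AA'}\Upsilon+\nabla_{AA'}\Upsilon,$$ $$\nabla^{AA'}\beta_{AA'}=-U^{AA'}\beta_{AA'},\qquad \nabla_{(A}{}^{A'}\beta_{B)A'}=U_{(A}{}^{A'}\beta_{B)A'},\qquad \nabla^{A}{}_{(A'}\beta_{|A|B')}=U^{A}{}_{(A'}\beta_{|A|B')}.$$ -/

import Mathlib

open Bundle FiberBundle
open scoped Manifold ContDiff ComplexConjugate

noncomputable section

namespace KillingSpinorMaxwell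

/-- The model space of a four-dimensional spacetime. -/
abbrev R4 : Type := EuclideanSpace ℝ (Fin 4)

/-- The model fibre of the bundle of (unprimed) spinors. -/
abbrev C2 : Type := EuclideanSpace ℂ (Fin 2)

section Lorentz

/-- The vector field `X` is smooth at `x`. -/
abbrev VecSmoothAt {M : Type*} [TopologicalSpace M] [ChartedSpace R4 M]
    [IsManifold (𝓡 4) ∞ M] (X : ∀ y : M, TangentSpace (𝓡 4) y) (x : M) : Prop :=
  ContMDiffAt (𝓡 4) ((𝓡 4).prod 𝓘(ℝ, R4)) ∞
    (fun y => TotalSpace.mk' R4 (E := (TangentSpace (𝓡 4) : M → Type _)) y (X y)) x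

/-- The vector field `X` is differentiable at `x`. -/
abbrev VecDiffAt {M : Type*} [TopologicalSpace M] [ChartedSpace R4 M]
    [IsManifold (𝓡 4) ∞ M] (X : ∀ y : M, TangentSpace (𝓡 4) y) (x : M) : Prop :=
  MDifferentiableAt (𝓡 4) ((𝓡 4).prod 𝓘(ℝ, R4))
    (fun y => TotalSpace.mk' R4 (E := (TangentSpace (𝓡 4) : M → Type _)) y (X y)) x

/-- The section `s` of a bundle with model fibre `C2` is smooth at `x`. -/
abbrev SpinSmoothAt {M : Type*} [TopologicalSpace M] [ChartedSpace R4 M]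
    {S : M → Type*} [TopologicalSpace (TotalSpace C2 S)] [∀ x, TopologicalSpace (S x)]
    [FiberBundle C2 S] (s : ∀ y : M, S y) (x : M) : Prop :=
  ContMDiffAt (𝓡 4) ((𝓡 4).prod 𝓘(ℝ, C2)) ∞ (fun y => TotalSpace.mk' C2 y (s y)) x

/-- The section `s` of a bundle with model fibre `C2` is differentiable at `x`. -/
abbrev SpinDiffAt {M : Type*} [TopologicalSpace M] [ChartedSpace R4 M]
    {S : M → Type*} [TopologicalSpace (TotalSpace C2 S)] [∀ x, TopologicalSpace (S x)]
    [FiberBundle C2 S] (s : ∀ y : M, S y) (x : M) : Prop :=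
  MDifferentiableAt (𝓡 4) ((𝓡 4).prod 𝓘(ℝ, C2)) (fun y => TotalSpace.mk' C2 y (s y)) x

/-- A smooth Lorentzian metric of signature `(+,-,-,-)` on a four-dimensional manifold. -/
structure LorentzMetric (M : Type*) [TopologicalSpace M] [ChartedSpace R4 M]
    [IsManifold (𝓡 4) ∞ M] where
  /-- The metric as a bilinear form on each tangent space. -/
  val : ∀ x : M, TangentSpace (𝓡 4) x →ₗ[ℝ] TangentSpace (𝓡 4) x →ₗ[ℝ] ℝ
  symm : ∀ x v w, val x v w = val x w v
  signature : ∀ x, ∃ e : Module.Basis (Fin 4) ℝ (TangentSpace (𝓡 4) x), ∀ i j,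
    val x (e i) (e j) = if i = j then (if i = 0 then 1 else -1) else 0
  smooth : ∀ (x : M) (X Y : ∀ y : M, TangentSpace (𝓡 4) y),
    VecSmoothAt X x → VecSmoothAt Y x →
      ContMDiffAt (𝓡 4) 𝓘(ℝ, ℝ) ∞ (fun y => val y (X y) (Y y)) x

variable {M : Type*} [TopologicalSpace M] [ChartedSpace R4 M] [IsManifold (𝓡 4) ∞ M]

/-- `D` is the Levi-Civita connection of `g`: it is torsion-free and `∇g = 0`.
(As everywhere in Mathlib, `D Y x v` stands for `(∇_v Y)(x)`.) -/
structure IsLeviCivita (g : LorentzMetric M)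
    (D : CovariantDerivative (𝓡 4) R4 (TangentSpace (𝓡 4) : M → Type _)) : Prop where
  torsion_free : D.torsion = 0
  metric : ∀ (x : M) (X Y : ∀ y : M, TangentSpace (𝓡 4) y) (v : TangentSpace (𝓡 4) x),
    VecDiffAt X x → VecDiffAt Y x →
      mvfderiv (𝓡 4) (fun y => g.val y (X y) (Y y)) x v = g.val x (D X x v) (Y x) + g.val x (X x) (D Y x v)

end Lorentz

section Spin

variable {M : Type*} [TopologicalSpace M] [ChartedSpace R4 M] [IsManifold (𝓡 4) ∞ M]
  {S : M → Type*} [TopologicalSpace (TotalSpace C2 S)]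
  [∀ x, AddCommGroup (S x)] [∀ x, Module ℂ (S x)] [∀ x, TopologicalSpace (S x)]
  [∀ x, IsTopologicalAddGroup (S x)] [∀ x, ContinuousSMul ℝ (S x)]
  [FiberBundle C2 S] [VectorBundle ℂ C2 S] [VectorBundle ℝ C2 S]
  [ContMDiffVectorBundle ∞ C2 S (𝓡 4)]

/-- Given, at a point, the real part `r s t` of the complex vector `s^A t̄^{A'}`, the spinor form
`α_{AA'} s^A t̄^{A'}` of a complex covector `α`. Since the assignment `(s,t) ↦ s^A t̄^{A'}` is
complex linear in `s`, its imaginary part is `- r (i s) t`, so that this is the complex-linear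
extension of `α` evaluated on `s^A t̄^{A'} = r s t - i r (i s) t`. -/
def spinorForm {T V : Type*} [AddCommGroup V] [Module ℂ V] (r : V → V → T) (α : T → ℂ)
    (s t : V) : ℂ :=
  α (r s t) - Complex.I * α (r (Complex.I • s) t)

/-- A spinor structure on the spacetime `(M, g)`: the rank-two complex vector bundle `S` carries a
spin metric `ε_{AB}`, and `S ⊗ S̄` is identified, compatibly with complex conjugation, with the
complexified tangent bundle in such a way that `g_{ab} = ε_{AB} ε̄_{A'B'}`.

The identification is given by the real part `vecRe x s t` of the complex vector `s^A t̄^{A'}`,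
that is, `½ (s^A t̄^{A'} + t^A s̄^{A'})`. The fields `vecRe_symm` and `vecRe_I` say precisely that
`vecRe` is the real part of a map `S ⊗ S̄ → ℂ ⊗ TM` which is complex linear in `s`, conjugate linear
in `t` and Hermitian; that this map is an isomorphism follows from `metric_eq`. -/
structure SpinorStructure (g : LorentzMetric M) (S : M → Type*)
    [TopologicalSpace (TotalSpace C2 S)]
    [∀ x, AddCommGroup (S x)] [∀ x, Module ℂ (S x)] [∀ x, TopologicalSpace (S x)]
    [∀ x, IsTopologicalAddGroup (S x)] [∀ x, ContinuousSMul ℝ (S x)]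
    [FiberBundle C2 S] [VectorBundle ℂ C2 S] [VectorBundle ℝ C2 S]
    [ContMDiffVectorBundle ∞ C2 S (𝓡 4)] where
  /-- The spin metric: `eps x s t = ε_{AB} s^A t^B`. -/
  eps : ∀ x : M, S x →ₗ[ℂ] S x →ₗ[ℂ] ℂ
  eps_alt : ∀ x s, eps x s s = 0
  exists_frame : ∀ x, ∃ o ι : S x, eps x o ι = 1
  eps_smooth : ∀ (x : M) (s t : ∀ y : M, S y), SpinSmoothAt s x → SpinSmoothAt t x →
    ContMDiffAt (𝓡 4) 𝓘(ℝ, ℂ) ∞ (fun y => eps y (s y) (t y)) x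
  /-- The real part of `s^A t̄^{A'}`. -/
  vecRe : ∀ x : M, S x →ₗ[ℝ] S x →ₗ[ℝ] TangentSpace (𝓡 4) x
  vecRe_symm : ∀ x s t, vecRe x s t = vecRe x t s
  vecRe_I : ∀ x s t, vecRe x (Complex.I • s) (Complex.I • t) = vecRe x s t
  vecRe_smooth : ∀ (x : M) (s t : ∀ y : M, S y), SpinSmoothAt s x → SpinSmoothAt t x →
    VecSmoothAt (fun y => vecRe y (s y) (t y)) x
  /-- `g_{ab} = ε_{AB} ε̄_{A'B'}`, evaluated on `s^A t̄^{A'}` and `u^B w̄^{B'}`. -/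
  metric_eq : ∀ x (s t u w : S x),
    spinorForm (fun s t => vecRe x s t)
      (fun v => spinorForm (fun u w => vecRe x u w) (fun v' => (g.val x v v' : ℂ)) u w) s t
      = eps x s u * conj (eps x t w)

/-- `nab` is the spin connection of the spinor structure: the complex-linear covariant derivative on
`S` under which `ε` is parallel and which induces on `TM` the Levi-Civita connection `D`. (These
properties determine it uniquely.) -/
structure IsSpinConnection {g : LorentzMetric M} (σ : SpinorStructure g S)
    (D : CovariantDerivative (𝓡 4) R4 (TangentSpace (𝓡 4) : M → Type _))
    (nab : CovariantDerivative (𝓡 4) C2 S) : Prop where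
  smul_I : ∀ (x : M) (s : ∀ y : M, S y) (v : TangentSpace (𝓡 4) x), SpinDiffAt s x →
    nab (fun y => Complex.I • s y) x v = Complex.I • nab s x v
  smooth : ∀ (x : M) (X : ∀ y : M, TangentSpace (𝓡 4) y) (s : ∀ y : M, S y),
    VecSmoothAt X x → SpinSmoothAt s x → SpinSmoothAt (fun y => nab s y (X y)) x
  eps_parallel : ∀ (x : M) (s t : ∀ y : M, S y) (v : TangentSpace (𝓡 4) x),
    SpinDiffAt s x → SpinDiffAt t x →
      mvfderiv (𝓡 4) (fun y => σ.eps y (s y) (t y)) x v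
        = σ.eps x (nab s x v) (t x) + σ.eps x (s x) (nab t x v)
  vecRe_parallel : ∀ (x : M) (s t : ∀ y : M, S y) (v : TangentSpace (𝓡 4) x),
    SpinDiffAt s x → SpinDiffAt t x →
      D (fun y => σ.vecRe y (s y) (t y)) x v
        = σ.vecRe x (nab s x v) (t x) + σ.vecRe x (s x) (nab t x v)

/-- A smooth symmetric spinor field `φ_{AB}` of valence `(2,0)`: `val x s t = φ_{AB} s^A t^B`. -/
structure SymSpinor (S : M → Type*)
    [TopologicalSpace (TotalSpace C2 S)]
    [∀ x, AddCommGroup (S x)] [∀ x, Module ℂ (S x)] [∀ x, TopologicalSpace (S x)]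
    [FiberBundle C2 S] where
  val : ∀ x : M, S x →ₗ[ℂ] S x →ₗ[ℂ] ℂ
  symm : ∀ x s t, val x s t = val x t s
  smooth : ∀ (x : M) (s t : ∀ y : M, S y), SpinSmoothAt s x → SpinSmoothAt t x →
    ContMDiffAt (𝓡 4) 𝓘(ℝ, ℂ) ∞ (fun y => val y (s y) (t y)) x

namespace SymSpinor

/-- The components `φ_{AB}` as a function of two spinor arguments. -/
def comp (φ : SymSpinor S) (x : M) (a b : S x) : ℂ := φ.val x a b

end SymSpinor

namespace SpinorStructure

variable {g : LorentzMetric M} (σ : SpinorStructure g S)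

/-! Spinor fields with two lower indices are handled through their values on spinors: a field
`β_{AA'}` is given by `β x a a' = β_{AA'} a^A ā'^{A'}`, complex linear in `a`, conjugate
linear in `a'`, and similarly for `φ_{AB}` and `φ_{A'B'}`. Indices are raised by
`κ^A = ε^{AB} κ_B`, where `ε^{AB} = o^A ι^B - ι^A o^B` for every spin frame, `ε_{AB} o^A ι^B = 1`. -/

/-- The first element of some spin frame at `x`. -/
def frameO (x : M) : S x := (σ.exists_frame x).choose

/-- The second element of some spin frame at `x`. -/
def frameI (x : M) : S x := (σ.exists_frame x).choose_spec.choose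

theorem eps_frame (x : M) : σ.eps x (σ.frameO x) (σ.frameI x) = 1 :=
  (σ.exists_frame x).choose_spec.choose_spec

/-- The contraction `ε^{AB} B_{AB}`; on primed indices, the contraction `ε̄^{A'B'} B_{A'B'}`.
It does not depend on the spin frame: see `up_eq` below. -/
def up (x : M) (B : S x → S x → ℂ) : ℂ :=
  B (σ.frameO x) (σ.frameI x) - B (σ.frameI x) (σ.frameO x)

/-- The directional derivative `∇_{AA'} f` (that is, `𝒯₀,₀ f`) of a complex scalar field. -/
def twist00 (f : M → ℂ) (x : M) (a a' : S x) : ℂ :=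
  spinorForm (fun s t => σ.vecRe x s t) (fun v => mvfderiv (𝓡 4) f x v) a a'

end SpinorStructure

/-- The covariant derivative `∇_v B_{CD}` (or `∇_v B_{CC'}`) of a two-index spinor field along a
real tangent vector, evaluated on `c`, `d`. By the Leibniz rule it does not depend on the choice of
the local sections extending `c` and `d`. -/
def covDeriv (nab : CovariantDerivative (𝓡 4) C2 S) (B : ∀ y : M, S y → S y → ℂ) (x : M)
    (c d : S x) (v : TangentSpace (𝓡 4) x) : ℂ :=
  mvfderiv (𝓡 4) (fun y => B y (extend C2 c y) (extend C2 d y)) x v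
    - B x (nab (extend C2 c) x v) d - B x c (nab (extend C2 d) x v)

namespace SpinorStructure

variable {g : LorentzMetric M} (σ : SpinorStructure g S) (nab : CovariantDerivative (𝓡 4) C2 S)

/-- `∇_{AA'} B_{CD}` (or `∇_{AA'} B_{CC'}`), evaluated on `a`, `a'`, `c`, `d`. -/
def del (B : ∀ y : M, S y → S y → ℂ) (x : M) (a a' c d : S x) : ℂ :=
  spinorForm (fun s t => σ.vecRe x s t) (covDeriv nab B x c d) a a'

/-- `(𝒯₂,₀ φ)_{ABCA'} = ∇_{(A|A'|} φ_{BC)}`. -/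
def twist20 (φ : ∀ y : M, S y → S y → ℂ) (x : M) (a b c a' : S x) : ℂ :=
  (1 / 6) * (σ.del nab φ x a a' b c + σ.del nab φ x a a' c b + σ.del nab φ x b a' a c
    + σ.del nab φ x b a' c a + σ.del nab φ x c a' a b + σ.del nab φ x c a' b a)

/-- `(𝒞†₂,₀ φ)_{AA'} = ∇^B_{A'} φ_{AB}`. -/
def curlDagger20 (φ : ∀ y : M, S y → S y → ℂ) (x : M) (a a' : S x) : ℂ :=
  σ.up x fun b c => σ.del nab φ x c a' a b

/-- `𝒟₁,₁ β = ∇^{BB'} β_{BB'}`. -/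
def div11 (β : ∀ y : M, S y → S y → ℂ) (x : M) : ℂ :=
  σ.up x fun b c => σ.up x fun b' c' => σ.del nab β x c c' b b'

/-- `(𝒞₁,₁ β)_{AB} = ∇_{(A}^{B'} β_{B)B'}`. -/
def curl11 (β : ∀ y : M, S y → S y → ℂ) (x : M) (a b : S x) : ℂ :=
  (1 / 2) * ((σ.up x fun b' c' => σ.del nab β x a c' b b')
    + σ.up x fun b' c' => σ.del nab β x b c' a b')

/-- `(𝒞†₁,₁ β)_{A'B'} = ∇^B_{(A'} β_{|B|B')}`. -/
def curlDagger11 (β : ∀ y : M, S y → S y → ℂ) (x : M) (a' b' : S x) : ℂ :=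
  (1 / 2) * ((σ.up x fun b c => σ.del nab β x c a' b b')
    + σ.up x fun b c => σ.del nab β x c b' b a')

/-- The full contraction `φ_{CD} ψ^{CD}` of two spinor fields of valence `(2,0)`. -/
def inner20 (φ ψ : ∀ y : M, S y → S y → ℂ) (x : M) : ℂ :=
  σ.up x fun c e => σ.up x fun d f => φ x c d * ψ x e f

/-- `U_{AA'} = -½ ∇_{AA'} log(-κ_{CD} κ^{CD})`, where `∇ log f = f⁻¹ ∇ f` for every
local branch of the logarithm. -/
def U (κ : SymSpinor S) (x : M) (a a' : S x) : ℂ :=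
  -(1 / 2) * (σ.twist00 (fun y => -σ.inner20 κ.comp κ.comp y) x a a'
    / (-σ.inner20 κ.comp κ.comp x))

/-- `Υ = κ^{AB} φ_{AB}`. -/
def Upsilon (κ φ : SymSpinor S) (x : M) : ℂ := σ.inner20 φ.comp κ.comp x

/-- `Θ_{AB} = -2 κ_{(A}^C φ_{B)C}`. -/
def Theta (κ φ : SymSpinor S) (x : M) (a b : S x) : ℂ :=
  -2 * ((1 / 2) * ((σ.up x fun c d => κ.comp x a d * φ.comp x b c)
    + σ.up x fun c d => κ.comp x b d * φ.comp x a c))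

/-- `β_{AA'} = (𝒞†₂,₀ Θ)_{AA'} + U^B_{A'} Θ_{AB}`. -/
def beta (κ φ : SymSpinor S) (x : M) (a a' : S x) : ℂ :=
  σ.curlDagger20 nab (σ.Theta κ φ) x a a'
    + σ.up x fun b c => σ.U κ x c a' * σ.Theta κ φ x a b

/-- `κ` is a Killing spinor of valence `(2,0)`: `(𝒯₂,₀ κ)_{ABCA'} = 0`. -/
def IsKillingSpinor (κ : SymSpinor S) : Prop :=
  ∀ (x : M) (a b c a' : S x), σ.twist20 nab κ.comp x a b c a' = 0

/-- `φ` solves the source-free Maxwell equation `(𝒞†₂,₀ φ)_{AA'} = 0`. -/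
def IsMaxwell (φ : SymSpinor S) : Prop :=
  ∀ (x : M) (a a' : S x), σ.curlDagger20 nab φ.comp x a a' = 0

/-- A spin frame is a basis: `v^A = (ε_{BC} v^B ι^C) o^A + (ε_{BC} o^B v^C) ι^A`. -/
theorem eq_frame (x : M) {o ι : S x} (h : σ.eps x o ι = 1) (v : S x) :
    v = σ.eps x v ι • o + σ.eps x o v • ι := by
  have hli : LinearIndependent ℂ ![o, ι] := by
    rw [LinearIndependent.pair_iff]
    intro p q hpq
    constructor
    · have := congrArg (fun w => σ.eps x w ι) hpq
      simpa [σ.eps_alt, h] using this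
    · have := congrArg (fun w => σ.eps x o w) hpq
      simpa [σ.eps_alt, h] using this
  have hfr : Module.finrank ℂ (S x) = 2 := by
    rw [LinearEquiv.finrank_eq ((trivializationAt C2 S x).continuousLinearEquivAt ℂ x
      (FiberBundle.mem_baseSet_trivializationAt C2 S x)).toLinearEquiv]
    simp
  have : FiniteDimensional ℂ (S x) := Module.finite_of_finrank_pos (by omega)
  have hspan := hli.span_eq_top_of_card_eq_finrank' (by simp [hfr])
  have hv : v ∈ Submodule.span ℂ (Set.range ![o, ι]) := by rw [hspan]; trivial
  rw [Matrix.range_cons, Matrix.range_cons, Matrix.range_empty, Set.union_empty,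
    Set.singleton_union, Submodule.mem_span_pair] at hv
  obtain ⟨p, q, rfl⟩ := hv
  simp [σ.eps_alt, h]

/-- The contraction may be computed in any spin frame, both on unprimed indices (`τ` the identity)
and on primed indices (`τ` complex conjugation). -/
theorem up_eq (x : M) {τ : ℂ →+* ℂ} (B : S x →ₛₗ[τ] S x →ₛₗ[τ] ℂ) {o ι : S x}
    (h : σ.eps x o ι = 1) : σ.up x (fun s t => B s t) = B o ι - B ι o := by
  have h0 := σ.eps_frame x
  unfold up
  have hdet : ∀ p q r s : ℂ, σ.eps x (p • o + q • ι) (r • o + s • ι) = p * s - q * r := by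
    intro p q r s
    have hanti : σ.eps x ι o = -1 := by
      have := σ.eps_alt x (o + ι)
      simp only [map_add, LinearMap.add_apply, σ.eps_alt, h] at this
      linear_combination this
    simp only [map_add, map_smul, LinearMap.add_apply, LinearMap.smul_apply, σ.eps_alt, h, hanti,
      smul_eq_mul]
    ring
  generalize σ.frameO x = o' at *
  generalize σ.frameI x = ι' at *
  rw [σ.eq_frame x h o', σ.eq_frame x h ι'] at h0 ⊢
  generalize σ.eps x o' ι = p at *
  generalize σ.eps x o o' = q at *
  generalize σ.eps x ι' ι = r at *
  generalize σ.eps x o ι' = s at *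
  rw [hdet] at h0
  have h1 : τ p * τ s - τ q * τ r = 1 := by
    rw [← map_mul, ← map_mul, ← map_sub, h0, map_one]
  simp only [map_add, LinearMap.map_smulₛₗ, LinearMap.add_apply, LinearMap.smul_apply, smul_eq_mul]
  linear_combination (B o ι - B ι o) * h1

end SpinorStructure

end Spin

end KillingSpinorMaxwell

end

/-!
Spinor arguments at a point are extended to sections that are parallel at that point; the covariant
derivative of a spinor field is then the ordinary derivative of its components, and the Leibniz
rules for fields are those for functions.

In a spin frame, the Killing and Maxwell equations turn `β` into the twisted gradient `(∇ - U) Υ`.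
Torsion-freeness makes the Hessian of a function symmetric, hence `U`, a multiple of a logarithmic
gradient, is closed. So the antisymmetrisation of `∇ (∇ - U) Υ` is `U ∧ (∇ - U) Υ`, which is the
content of the two curl equations.

For the divergence, `β` is dual to the three-form `(d + U ∧ ·)` of the two-form `Θ_{BC} ε̄_{B'C'}`,
and `(d + U ∧ ·)² = 0` since `U` is closed. Writing the two-form as a finite sum of terms
`f dp ∧ dq` in local coordinates, this too needs only the symmetry of Hessians of functions; the
curvature of the spin connection never enters.
-/

noncomputable section

namespace KillingSpinorMaxwell

section Calculus

variable {𝕜 : Type*} [NontriviallyNormedField 𝕜]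
  {E : Type*} [NormedAddCommGroup E] [NormedSpace 𝕜 E]
  {H : Type*} [TopologicalSpace H] {I : ModelWithCorners 𝕜 E H}
  {M : Type*} [TopologicalSpace M] [ChartedSpace H M]
  {F : Type*} [NormedAddCommGroup F] [NormedSpace 𝕜 F]
  {G : Type*} [NormedAddCommGroup G] [NormedSpace 𝕜 G] {x : M}

theorem mvfderiv_congr {f g : M → F} (h : f =ᶠ[nhds x] g) (v : TangentSpace I x) :
    mvfderiv I f x v = mvfderiv I g x v :=
  congrArg (fun L : E →L[𝕜] F => L v) (h.mfderiv_eq (I := I) (I' := 𝓘(𝕜, F)))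

theorem mvfderiv_comp_differentiableAt {L : F → G} {f : M → F}
    (hL : DifferentiableAt 𝕜 L (f x)) (hf : MDifferentiableAt I 𝓘(𝕜, F) f x)
    (v : TangentSpace I x) :
    mvfderiv I (fun y => L (f y)) x v = fderiv 𝕜 L (f x) (mvfderiv I f x v) :=
  (mfderiv_comp_apply x hL.mdifferentiableAt hf v).trans (by rw [mfderiv_eq_fderiv]; rfl)

theorem mvfderiv_mul_apply {A : Type*} [NormedCommRing A] [NormedAlgebra 𝕜 A] {f g : M → A}
    (hf : MDifferentiableAt I 𝓘(𝕜, A) f x) (hg : MDifferentiableAt I 𝓘(𝕜, A) g x)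
    (v : TangentSpace I x) :
    mvfderiv I (fun y => f y * g y) x v = f x * mvfderiv I g x v + mvfderiv I f x v * g x := by
  have h := (hf.hasMFDerivAt.mul hg.hasMFDerivAt).mfderiv
  exact (congrArg (fun L : E →L[𝕜] A => L v) h).trans
    (congrArg (f x * mvfderiv I g x v + ·) (mul_comm _ _))

theorem mdifferentiableAt_fun_sum {ι : Type} {s : Finset ι} {f : ι → M → F}
    (hf : ∀ i ∈ s, MDifferentiableAt I 𝓘(𝕜, F) (f i) x) :
    MDifferentiableAt I 𝓘(𝕜, F) (fun y => ∑ i ∈ s, f i y) x := by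
  simpa only [Finset.sum_fn] using MDifferentiableAt.sum hf

theorem mvfderiv_fun_sum {ι : Type} {s : Finset ι} {f : ι → M → F}
    (hf : ∀ i ∈ s, MDifferentiableAt I 𝓘(𝕜, F) (f i) x) :
    mvfderiv I (fun y => ∑ i ∈ s, f i y) x = ∑ i ∈ s, mvfderiv I (f i) x := by
  have h := (HasMFDerivAt.sum fun i hi => (hf i hi).hasMFDerivAt).mfderiv
  rw [Finset.sum_fn] at h
  exact h

end Calculus

section Bracket

open VectorField

variable {𝕜 : Type*} [RCLike 𝕜]
  {E : Type*} [NormedAddCommGroup E] [NormedSpace 𝕜 E]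
  {H : Type*} [TopologicalSpace H] {I : ModelWithCorners 𝕜 E H}
  {M : Type*} [TopologicalSpace M] [ChartedSpace H M]
  {F : Type*} [NormedAddCommGroup F] [NormedSpace 𝕜 F] {x : M}

variable [IsManifold I 1 M]

theorem contMDiffAt_mvfderiv_apply {n m : ℕ∞ω} {f : M → F}
    {X : ∀ y : M, TangentSpace I y} (hf : ContMDiffAt I 𝓘(𝕜, F) n f x)
    (hX : ContMDiffAt I I.tangent m (fun y => (X y : TangentBundle I M)) x) (hmn : m + 1 ≤ n) :
    ContMDiffAt I 𝓘(𝕜, F) m (fun y => mvfderiv I f y (X y)) x := by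
  have hderiv := hf.mfderiv_const (m := m) hmn
  have happly := ContMDiffAt.clm_apply_of_inCoordinates (b₁ := id) (b₂ := f) hderiv hX
    (hf.of_le (le_self_add.trans hmn))
  exact (contMDiff_snd_tangentBundle_modelSpace F 𝓘(𝕜, F)).contMDiffAt.comp x happly

theorem mvfderiv_extChartAt_symm [CompleteSpace E] {f : M → F} {z : E}
    (hz : z ∈ (extChartAt I x).target)
    (hf : MDifferentiableAt I 𝓘(𝕜, F) f ((extChartAt I x).symm z))
    (X : ∀ y : M, TangentSpace I y) :
    mvfderiv I f ((extChartAt I x).symm z) (X ((extChartAt I x).symm z))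
      = fderivWithin 𝕜 (f ∘ (extChartAt I x).symm) (Set.range I) z
        (mpullbackWithin 𝓘(𝕜, E) I (extChartAt I x).symm X (Set.range I) z) := by
  have hsymm := mdifferentiableWithinAt_extChartAt_symm hz
  obtain ⟨e, he⟩ := isInvertible_mfderivWithin_extChartAt_symm hz
  rw [mpullbackWithin_apply, ← mfderivWithin_eq_fderivWithin,
    mfderiv_comp_mfderivWithin z hf hsymm
      (I.uniqueMDiffOn z (extChartAt_target_subset_range x hz)), ← he,
    ContinuousLinearMap.inverse_equiv]
  exact congrArg (mvfderiv I f _) (e.apply_symm_apply _).symm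

omit [IsManifold I 1 M] in
theorem mvfderiv_eq_fderivWithin_extChartAt {f : M → F} (hf : MDifferentiableAt I 𝓘(𝕜, F) f x)
    (v : TangentSpace I x) :
    mvfderiv I f x v
      = fderivWithin 𝕜 (f ∘ (extChartAt I x).symm) (Set.range I) (extChartAt I x x) v :=
  congrArg (fun L : E →L[𝕜] F => L v) hf.mfderiv

theorem mlieBracket_eq_lieBracketWithin_extChartAt (V W : ∀ y : M, TangentSpace I y) :
    mlieBracket I V W x = lieBracketWithin 𝕜
      (mpullbackWithin 𝓘(𝕜, E) I (extChartAt I x).symm V (Set.range I))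
      (mpullbackWithin 𝓘(𝕜, E) I (extChartAt I x).symm W (Set.range I))
      (Set.range I) (extChartAt I x x) := by
  rw [← mlieBracketWithin_univ, mlieBracketWithin_apply, mfderiv_extChartAt_self,
    Set.preimage_univ, Set.univ_inter]
  exact congrArg (fun L : E →L[𝕜] E => L _) ContinuousLinearMap.inverse_id

theorem eventually_mvfderiv_comp_extChartAt_symm [CompleteSpace E] {f : M → F}
    (hf : ContMDiffAt I 𝓘(𝕜, F) 1 f x) (X : ∀ y : M, TangentSpace I y) :
    (fun y => mvfderiv I f y (X y)) ∘ (extChartAt I x).symm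
      =ᶠ[nhdsWithin (extChartAt I x x) (Set.range I)]
      fun z => fderivWithin 𝕜 (f ∘ (extChartAt I x).symm) (Set.range I) z
        (mpullbackWithin 𝓘(𝕜, E) I (extChartAt I x).symm X (Set.range I) z) := by
  have hdiff : ∀ᶠ y in nhds x, MDifferentiableAt I 𝓘(𝕜, F) f y := by
    filter_upwards [(contMDiffAt_iff_contMDiffAt_nhds (by simp)).1 hf] with y hy
    exact hy.mdifferentiableAt one_ne_zero
  have htendsto : Filter.Tendsto (extChartAt I x).symm
      (nhdsWithin (extChartAt I x x) (Set.range I)) (nhds x) := by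
    simpa only [ContinuousAt, extChartAt_to_inv] using
      (continuousAt_extChartAt_symm (I := I) x).mono_left nhdsWithin_le_nhds
  filter_upwards [htendsto.eventually hdiff, extChartAt_target_mem_nhdsWithin x] with z hz hzt
  exact mvfderiv_extChartAt_symm hzt hz X

theorem mvfderiv_mlieBracket [CompleteSpace E] [IsManifold I 2 M] {f : M → F}
    {V W : ∀ y : M, TangentSpace I y} (hf : ContMDiffAt I 𝓘(𝕜, F) 2 f x)
    (hV : ContMDiffAt I I.tangent 1 (fun y => (V y : TangentBundle I M)) x)
    (hW : ContMDiffAt I I.tangent 1 (fun y => (W y : TangentBundle I M)) x) :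
    mvfderiv I f x (mlieBracket I V W x)
      = mvfderiv I (fun y => mvfderiv I f y (W y)) x (V x)
        - mvfderiv I (fun y => mvfderiv I f y (V y)) x (W x) := by
  have hf1 : ContMDiffAt I 𝓘(𝕜, F) 1 f x := hf.of_le one_le_two
  have hpull {X : ∀ y : M, TangentSpace I y}
      (hX : ContMDiffAt I I.tangent 1 (fun y => (X y : TangentBundle I M)) x) :
      DifferentiableWithinAt 𝕜 (mpullbackWithin 𝓘(𝕜, E) I (extChartAt I x).symm X (Set.range I))
        (Set.range I) (extChartAt I x x) := by
    have h := (hX.mdifferentiableAt one_ne_zero).mdifferentiableWithinAt (s := Set.univ)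
      |>.differentiableWithinAt_mpullbackWithin_vectorField
    rwa [Set.preimage_univ, Set.univ_inter] at h
  have hderiv {X Y : ∀ y : M, TangentSpace I y}
      (hX : ContMDiffAt I I.tangent 1 (fun y => (X y : TangentBundle I M)) x) :
      mvfderiv I (fun y => mvfderiv I f y (X y)) x (Y x)
        = fderivWithin 𝕜 (fun z => fderivWithin 𝕜 (f ∘ (extChartAt I x).symm) (Set.range I) z
            (mpullbackWithin 𝓘(𝕜, E) I (extChartAt I x).symm X (Set.range I) z)) (Set.range I)
          (extChartAt I x x)
          (mpullbackWithin 𝓘(𝕜, E) I (extChartAt I x).symm Y (Set.range I) (extChartAt I x x)) := by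
    have hdfX := (contMDiffAt_mvfderiv_apply hf hX (one_add_one_eq_two (R := ℕ∞ω)).le)
      |>.mdifferentiableAt one_ne_zero
    have hpt := extChartAt_to_inv (I := I) x
    have h := mvfderiv_extChartAt_symm (mem_extChartAt_target (I := I) x) (hpt.symm ▸ hdfX) Y
    rw [(eventually_mvfderiv_comp_extChartAt_symm hf1 X).fderivWithin_eq_of_mem
      (Set.mem_range_self _), hpt] at h
    exact h
  rw [mvfderiv_eq_fderivWithin_extChartAt (hf1.mdifferentiableAt one_ne_zero),
    mlieBracket_eq_lieBracketWithin_extChartAt, hderiv hV, hderiv hW]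
  exact fderivWithin_apply_lieBracket (contMDiffAt_iff.1 hf).2
    (minSmoothness_of_isRCLikeNormedField.le) I.uniqueDiffOn
    (I.range_subset_closure_interior (Set.mem_range_self _)) (Set.mem_range_self _)
    (hpull hW) (hpull hV)

end Bracket

section Semilinear

/-- `h` is semilinear with respect to `τ`. This is a predicate on mere functions because a spinor
field is given by its values on spinor arguments, not as a bundled multilinear map. -/
structure IsSemilinear {V : Type*} [AddCommGroup V] [Module ℂ V] (τ : ℂ →+* ℂ) (h : V → ℂ) :
    Prop where
  add : ∀ s t, h (s + t) = h s + h t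
  smul : ∀ z s, h (z • s) = τ z * h s

variable {V : Type*} [AddCommGroup V] [Module ℂ V]

theorem real_smul_add_real_smul_I (z : ℂ) (s : V) :
    z • s = z.re • s + z.im • (Complex.I • s) := by
  conv_lhs => rw [← Complex.re_add_im z]
  rw [add_smul, mul_smul, Complex.coe_smul, Complex.coe_smul]

theorem I_smul_I_smul (s : V) : Complex.I • Complex.I • s = -s := by
  rw [smul_smul, Complex.I_mul_I, neg_one_smul]

namespace IsSemilinear

variable {τ : ℂ →+* ℂ} {h k : V → ℂ}

/-- A semilinear function as a real-linear map, when `τ` fixes the real numbers. -/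
def toRealLinearMap (hh : IsSemilinear τ h) (hτ : ∀ r : ℝ, τ r = r) : V →ₗ[ℝ] ℂ where
  toFun := h
  map_add' := hh.add
  map_smul' r s := by rw [← Complex.coe_smul, hh.smul, hτ, RingHom.id_apply, Complex.real_smul]

theorem of_smul_add (H : ∀ z s t, h (z • s + t) = τ z * h s + h t) : IsSemilinear τ h := by
  have h0 : h 0 = 0 := by simpa using H 1 0 0
  exact ⟨fun s t => by simpa using H 1 s t, fun z s => by simpa [h0] using H z s 0⟩

theorem add_fun (hh : IsSemilinear τ h) (hk : IsSemilinear τ k) :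
    IsSemilinear τ fun s => h s + k s where
  add s t := by rw [hh.add, hk.add]; ring
  smul z s := by rw [hh.smul, hk.smul]; ring

theorem const_mul (hh : IsSemilinear τ h) (c : ℂ) : IsSemilinear τ fun s => c * h s where
  add s t := by rw [hh.add]; ring
  smul z s := by rw [hh.smul]; ring

theorem mul_const (hh : IsSemilinear τ h) (c : ℂ) : IsSemilinear τ fun s => h s * c where
  add s t := by rw [hh.add]; ring
  smul z s := by rw [hh.smul]; ring

end IsSemilinear

variable {T : Type*} [AddCommGroup T] [Module ℝ T] (r : V →ₗ[ℝ] V →ₗ[ℝ] T) (α : T →ₗ[ℝ] ℂ)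

theorem spinorForm_isSemilinear_left (t : V) :
    IsSemilinear (RingHom.id ℂ) fun s => spinorForm (fun s t => r s t) α s t where
  add s s' := by
    simp only [spinorForm, map_add, smul_add, LinearMap.add_apply]
    ring
  smul z s := by
    have key (w : V) : r (z • w) t = z.re • r w t + z.im • r (Complex.I • w) t := by
      rw [real_smul_add_real_smul_I z w, map_add, map_smul, map_smul]
      rfl
    simp only [spinorForm, smul_comm Complex.I z, key, I_smul_I_smul, map_add, map_smul, map_neg,
      LinearMap.neg_apply, Complex.real_smul, RingHom.id_apply]
    linear_combination
      (α (r s t) - Complex.I * α (r (Complex.I • s) t)) * Complex.re_add_im z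
        + z.im * α (r (Complex.I • s) t) * Complex.I_mul_I

theorem spinorForm_isSemilinear_right
    (hr : ∀ s t, r (Complex.I • s) (Complex.I • t) = r s t) (s : V) :
    IsSemilinear (starRingEnd ℂ) fun t => spinorForm (fun s t => r s t) α s t where
  add t t' := by
    simp only [spinorForm, map_add]
    ring
  smul z t := by
    have hrI (s t : V) : r s (Complex.I • t) = -r (Complex.I • s) t := by
      rw [← hr (Complex.I • s) t, I_smul_I_smul, map_neg, LinearMap.neg_apply, neg_neg]
    have key (w : V) : r w (z • t) = z.re • r w t - z.im • r (Complex.I • w) t := by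
      rw [real_smul_add_real_smul_I z t, map_add, map_smul, map_smul, hrI, smul_neg, sub_eq_add_neg]
    have hconj : conj z = (z.re : ℂ) - z.im * Complex.I := by
      apply Complex.ext <;> simp
    simp only [spinorForm, key, I_smul_I_smul, map_sub, map_smul, map_neg, LinearMap.neg_apply,
      Complex.real_smul, smul_neg, hconj]
    linear_combination (-z.im * α (r (Complex.I • s) t)) * Complex.I_mul_I

end Semilinear

section Extension

variable {𝕜 : Type*} [NontriviallyNormedField 𝕜] {B : Type*} [TopologicalSpace B]
  (F : Type*) [NormedAddCommGroup F] [NormedSpace 𝕜 F]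
  {V : B → Type*} [∀ x, AddCommGroup (V x)] [∀ x, Module 𝕜 (V x)]
  [∀ x, TopologicalSpace (V x)] [TopologicalSpace (TotalSpace F V)] [FiberBundle F V]
  [VectorBundle 𝕜 F V] {x : B}

theorem eventually_extend_smul_add (z : 𝕜) (c d : V x) :
    ∀ᶠ y in nhds x, extend F (z • c + d) y = z • extend F c y + extend F d y := by
  filter_upwards [(trivializationAt F V x).open_baseSet.mem_nhds
    (mem_baseSet_trivializationAt' x)] with y hy
  have hlin := (Trivialization.linear 𝕜 (trivializationAt F V x) (mem_baseSet_trivializationAt' x))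
  simp only [extend]
  rw [← Trivialization.coe_symmₗ (R := 𝕜) _ hy, ← map_smul, ← map_add]
  exact congrArg _ ((hlin.map_add _ _).trans (congrArg (· + _) (hlin.map_smul z c)))

end Extension

section Coordinates

theorem linearMap_apply_eq_sum_single {W : Type*} [AddCommGroup W] [Module ℝ W]
    (L : R4 →ₗ[ℝ] W) (v : R4) : L v = ∑ j, v j • L (EuclideanSpace.single j 1) := by
  conv_lhs => rw [← (EuclideanSpace.basisFun (Fin 4) ℝ).sum_repr v]
  simp only [EuclideanSpace.basisFun_repr, EuclideanSpace.basisFun_apply, map_sum, map_smul]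

variable {M : Type*} [TopologicalSpace M] [ChartedSpace R4 M] [IsManifold (𝓡 4) ∞ M] {x : M}

/-- The `j`-th coordinate of the preferred chart at `x`. -/
def chartCoord (x : M) (j : Fin 4) (y : M) : ℝ := extChartAt (𝓡 4) x y j

theorem contMDiffAt_chartCoord {y : M} (hy : y ∈ (chartAt R4 x).source) (j : Fin 4) :
    ContMDiffAt (𝓡 4) 𝓘(ℝ, ℝ) ∞ (chartCoord x j) y :=
  (EuclideanSpace.proj (𝕜 := ℝ) j).contDiff.contMDiff.contMDiffAt.comp y
    (contMDiffAt_extChartAt' hy)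

theorem mdifferentiableAt_chartCoord_sub (j : Fin 4) :
    MDifferentiableAt (𝓡 4) 𝓘(ℝ, ℝ) (fun y => chartCoord x j x - chartCoord x j y) x :=
  mdifferentiableAt_const.sub
    ((contMDiffAt_chartCoord (mem_chart_source _ x) j).mdifferentiableAt (by simp))

theorem mvfderiv_chartCoord {y : M} (hy : y ∈ (chartAt R4 x).source) (j : Fin 4)
    (v : TangentSpace (𝓡 4) y) :
    mvfderiv (𝓡 4) (chartCoord x j) y v
      = EuclideanSpace.proj (𝕜 := ℝ) j (mfderiv (𝓡 4) 𝓘(ℝ, R4) (extChartAt (𝓡 4) x) y v) := by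
  have h := mvfderiv_comp_differentiableAt (L := EuclideanSpace.proj (𝕜 := ℝ) j)
    (EuclideanSpace.proj (𝕜 := ℝ) j).differentiableAt (mdifferentiableAt_extChartAt hy) v
  rwa [ContinuousLinearMap.fderiv] at h

theorem mvfderiv_chartCoord_self (j : Fin 4) (v : TangentSpace (𝓡 4) x) :
    mvfderiv (𝓡 4) (chartCoord x j) x v = EuclideanSpace.proj (𝕜 := ℝ) j v :=
  (mvfderiv_chartCoord (mem_chart_source _ x) j v).trans
    (congrArg (fun L : R4 →L[ℝ] R4 => L v j) (mfderiv_extChartAt_self (I := 𝓡 4) (x := x)))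

theorem mvfderiv_chartCoord_sub (j : Fin 4) (v : TangentSpace (𝓡 4) x) :
    mvfderiv (𝓡 4) (fun y => chartCoord x j x - chartCoord x j y) x v
      = -EuclideanSpace.proj (𝕜 := ℝ) j v := by
  have hX : MDifferentiableAt (𝓡 4) 𝓘(ℝ, ℝ) (chartCoord x j) x :=
    (contMDiffAt_chartCoord (mem_chart_source _ x) j).mdifferentiableAt (by simp)
  rw [mvfderiv_fun_sub mdifferentiableAt_const hX, mvfderiv_const, zero_sub, neg_apply,
    mvfderiv_chartCoord_self]

end Coordinates

section Sections

variable {M : Type*} [TopologicalSpace M] [ChartedSpace R4 M]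
  {S : M → Type*} [TopologicalSpace (TotalSpace C2 S)]
  [∀ x, AddCommGroup (S x)] [∀ x, TopologicalSpace (S x)] [FiberBundle C2 S]
  {x : M} {s t : ∀ y : M, S y}

omit [∀ x, AddCommGroup (S x)] in
theorem SpinSmoothAt.spinDiffAt (h : SpinSmoothAt s x) : SpinDiffAt s x :=
  ContMDiffAt.mdifferentiableAt h (by simp)

variable [∀ x, Module ℂ (S x)]

theorem SpinSmoothAt.smul_I [VectorBundle ℂ C2 S] (h : SpinSmoothAt s x) :
    SpinSmoothAt (fun y => Complex.I • s y) x := by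
  rw [SpinSmoothAt, contMDiffAt_section] at h ⊢
  have hsmul : ContMDiffAt (𝓡 4) 𝓘(ℝ, C2) ∞
      (fun y => (Complex.I • (trivializationAt C2 S x ⟨y, s y⟩).2 : C2)) x :=
    (contDiff_const_smul (𝕜 := ℝ) Complex.I).contDiffAt.contMDiffAt.comp x h
  refine hsmul.congr_of_eventuallyEq ?_
  filter_upwards [(trivializationAt C2 S x).open_baseSet.mem_nhds
    (mem_baseSet_trivializationAt' x)] with y hy
  exact (Trivialization.linear ℂ _ hy).map_smul _ _

variable [∀ x, IsTopologicalAddGroup (S x)] [∀ x, ContinuousSMul ℝ (S x)] [VectorBundle ℝ C2 S]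

omit [∀ x, IsTopologicalAddGroup (S x)] [∀ x, ContinuousSMul ℝ (S x)] in
theorem SpinSmoothAt.smul_add [VectorBundle ℂ C2 S] (hs : SpinSmoothAt s x)
    (ht : SpinSmoothAt t x) (z : ℂ) : SpinSmoothAt (fun y => z • s y + t y) x := by
  have hre : SpinSmoothAt (fun y => z.re • s y) x := contMDiffAt_const.smul_section hs
  have him : SpinSmoothAt (fun y => z.im • Complex.I • s y) x :=
    contMDiffAt_const.smul_section hs.smul_I
  simp only [real_smul_add_real_smul_I z]
  exact (hre.add_section him).add_section ht

variable {nab : CovariantDerivative (𝓡 4) C2 S}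

theorem nab_sum_smul {ι : Type*} (A : Finset ι) {f : ι → M → ℝ} {s : ι → ∀ y : M, S y}
    (hf : ∀ i, MDifferentiableAt (𝓡 4) 𝓘(ℝ, ℝ) (f i) x) (hs : ∀ i, SpinDiffAt (s i) x)
    (v : TangentSpace (𝓡 4) x) :
    nab (fun y => ∑ i ∈ A, f i y • s i y) x v
      = ∑ i ∈ A, (f i x • nab (s i) x v + mvfderiv (𝓡 4) (f i) x v • s i x) := by
  classical
  induction A using Finset.induction_on with
  | empty => exact congrArg (fun L => L x v) nab.zero
  | insert i A hi ih =>
    have hi' : SpinDiffAt (fun y => f i y • s i y) x := (hf i).smul_section (hs i)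
    have hA : SpinDiffAt (fun y => ∑ i ∈ A, f i y • s i y) x :=
      .sum_section fun j _ => (hf j).smul_section (hs j)
    simp only [Finset.sum_insert hi]
    have hadd := congrArg (fun L => L v) (nab.isCovariantDerivativeOnUniv.add hi' hA)
    have hleib := congrArg (fun L => L v) (nab.isCovariantDerivativeOnUniv.leibniz (hs i) (hf i))
    exact hadd.trans (congrArg₂ (· + ·) hleib ih)

/-- The section with value `c` at `x` whose covariant derivative vanishes at `x`, obtained from a
smooth extension of `c` by subtracting its covariant derivative to first order in the chart. -/
def parallelExtend (nab : CovariantDerivative (𝓡 4) C2 S) (c : S x) (y : M) : S y :=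
  extend C2 c y + ∑ j, (chartCoord x j x - chartCoord x j y) •
    extend C2 (nab (extend C2 c) x (EuclideanSpace.single j (1 : ℝ))) y

omit [VectorBundle ℝ C2 S] in
theorem parallelExtend_self (c : S x) : parallelExtend nab c x = c := by
  simp only [parallelExtend, sub_self, zero_smul, Finset.sum_const_zero, add_zero,
    extend_apply_self]

variable [IsManifold (𝓡 4) ∞ M]

theorem spinSmoothAt_parallelExtend (c : S x) : SpinSmoothAt (parallelExtend nab c) x := by
  refine (contMDiffAt_extend (𝓡 4) C2 c).add_section (.sum_section fun j _ =>
    ContMDiffAt.smul_section ?_ (contMDiffAt_extend (𝓡 4) C2 _))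
  exact contMDiffAt_const.sub (contMDiffAt_chartCoord (mem_chart_source _ x) j)

theorem nab_parallelExtend (c : S x) (v : TangentSpace (𝓡 4) x) :
    nab (parallelExtend nab c) x v = 0 := by
  have hext (d : S x) : SpinDiffAt (extend C2 d) x :=
    SpinSmoothAt.spinDiffAt (contMDiffAt_extend (𝓡 4) C2 d)
  have hcorr := nab_sum_smul (nab := nab) Finset.univ mdifferentiableAt_chartCoord_sub
    (fun j => hext (nab (extend C2 c) x (EuclideanSpace.single j 1))) v
  have hadd := congrArg (fun L => L v) (nab.isCovariantDerivativeOnUniv.add (hext c)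
    (.sum_section (s := Finset.univ) fun j _ => (mdifferentiableAt_chartCoord_sub j).smul_section
      (hext (nab (extend C2 c) x (EuclideanSpace.single j 1)))))
  refine (hadd.trans (congrArg (nab (extend C2 c) x v + ·) hcorr)).trans ?_
  have hv := linearMap_apply_eq_sum_single (nab (extend C2 c) x).toLinearMap v
  simp only [sub_self, zero_smul, zero_add, extend_apply_self, mvfderiv_chartCoord_sub, neg_smul,
    Finset.sum_neg_distrib]
  exact add_neg_eq_zero.2 hv

variable [VectorBundle ℂ C2 S] [ContMDiffVectorBundle ∞ C2 S (𝓡 4)]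
  {g : LorentzMetric M} {σ : SpinorStructure g S}
  {D : CovariantDerivative (𝓡 4) R4 (TangentSpace (𝓡 4) : M → Type _)}

namespace IsSpinConnection

theorem nab_smul_add (h : IsSpinConnection σ D nab) (hs : SpinSmoothAt s x)
    (ht : SpinSmoothAt t x) (z : ℂ) (v : TangentSpace (𝓡 4) x) :
    nab (fun y => z • s y + t y) x v = z • nab s x v + nab t x v := by
  have hI := hs.smul_I.spinDiffAt
  have hsum := nab_sum_smul (nab := nab) Finset.univ (x := x)
    (f := ![fun _ => z.re, fun _ => z.im, fun _ => 1]) (s := ![s, fun y => Complex.I • s y, t])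
    (fun i => by fin_cases i <;> exact mdifferentiableAt_const)
    (fun i => by fin_cases i <;> [exact hs.spinDiffAt; exact hI; exact ht.spinDiffAt]) v
  simp only [Fin.sum_univ_three, Matrix.cons_val_zero, Matrix.cons_val_one, Matrix.cons_val,
    mvfderiv_const, one_smul, zero_apply, zero_smul, add_zero,
    h.smul_I x s v hs.spinDiffAt, ← real_smul_add_real_smul_I] at hsum
  exact hsum

theorem nab_extend_smul_add (h : IsSpinConnection σ D nab) (z : ℂ) (c d : S x)
    (v : TangentSpace (𝓡 4) x) :
    nab (extend C2 (z • c + d)) x v = z • nab (extend C2 c) x v + nab (extend C2 d) x v := by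
  have hext (c : S x) : SpinSmoothAt (extend C2 c) x := contMDiffAt_extend (𝓡 4) C2 c
  have hsum : SpinSmoothAt (fun y => z • extend C2 c y + extend C2 d y) x :=
    (hext c).smul_add (hext d) z
  rw [nab.isCovariantDerivativeOnUniv.congr_of_eventuallyEq (hext _).spinDiffAt
    hsum.spinDiffAt Filter.univ_mem (eventually_extend_smul_add C2 z c d)]
  simpa only [extend_apply_self] using h.nab_smul_add (hext c) (hext d) z v

theorem eventually_parallelExtend_smul_add (h : IsSpinConnection σ D nab) (z : ℂ) (c d : S x) :
    ∀ᶠ y in nhds x,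
      parallelExtend nab (z • c + d) y = z • parallelExtend nab c y + parallelExtend nab d y := by
  have hnab (j : Fin 4) := h.nab_extend_smul_add z c d (EuclideanSpace.single j (1 : ℝ))
  filter_upwards [eventually_extend_smul_add C2 z c d, Filter.eventually_all.2 fun j =>
    eventually_extend_smul_add C2 z (nab (extend C2 c) x (EuclideanSpace.single j (1 : ℝ)))
      (nab (extend C2 d) x (EuclideanSpace.single j (1 : ℝ)))] with y hy hyj
  simp only [← hnab] at hyj
  simp only [parallelExtend, hy, hyj, smul_add, Finset.sum_add_distrib, Finset.smul_sum,
    smul_comm z (_ : ℝ)]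
  abel

end IsSpinConnection

end Sections

section Fields

/-- The complex function `f` is smooth at `x`. -/
abbrev FunSmoothAt {M : Type*} [TopologicalSpace M] [ChartedSpace R4 M] (f : M → ℂ) (x : M) :
    Prop :=
  ContMDiffAt (𝓡 4) 𝓘(ℝ, ℂ) ∞ f x

namespace FunSmoothAt

variable {M : Type*} [TopologicalSpace M] [ChartedSpace R4 M] {f k : M → ℂ} {x : M}

theorem mdifferentiableAt (h : FunSmoothAt f x) : MDifferentiableAt (𝓡 4) 𝓘(ℝ, ℂ) f x :=
  ContMDiffAt.mdifferentiableAt h (by simp)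

theorem mul (hf : FunSmoothAt f x) (hk : FunSmoothAt k x) : FunSmoothAt (fun y => f y * k y) x :=
  ContMDiffAt.comp (I' := 𝓘(ℝ, ℂ × ℂ)) x (g := fun p : ℂ × ℂ => p.1 * p.2)
    contDiff_mul.contDiffAt.contMDiffAt (hf.prodMk_space hk)

theorem add (hf : FunSmoothAt f x) (hk : FunSmoothAt k x) : FunSmoothAt (fun y => f y + k y) x :=
  ContMDiffAt.add hf hk

theorem sub (hf : FunSmoothAt f x) (hk : FunSmoothAt k x) : FunSmoothAt (fun y => f y - k y) x :=
  ContMDiffAt.sub hf hk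

theorem inv (hf : FunSmoothAt f x) (hx : f x ≠ 0) : FunSmoothAt (fun y => (f y)⁻¹) x :=
  ContMDiffAt.comp x (contDiffAt_inv ℝ hx).contMDiffAt hf

theorem of_mul (hfk : FunSmoothAt (fun y => f y * k y) x)
    (hk : FunSmoothAt k x) (hx : k x ≠ 0) : FunSmoothAt f x := by
  refine (hfk.mul (hk.inv hx)).congr_of_eventuallyEq ?_
  filter_upwards [(ContMDiffAt.continuousAt hk).eventually_ne hx] with y hy
  rw [mul_inv_cancel_right₀ hy]

theorem ofReal {r : M → ℝ} (hr : ContMDiffAt (𝓡 4) 𝓘(ℝ, ℝ) ∞ r x) :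
    FunSmoothAt (fun y => (r y : ℂ)) x :=
  ContMDiffAt.comp x (g := Complex.ofRealCLM)
    Complex.ofRealCLM.contDiff.contDiffAt.contMDiffAt hr

end FunSmoothAt

theorem FunSmoothAt.conj {M : Type*} [TopologicalSpace M] [ChartedSpace R4 M] {f : M → ℂ} {x : M}
    (hf : FunSmoothAt f x) : FunSmoothAt (fun y => conj (f y)) x :=
  ContMDiffAt.comp x (g := Complex.conjCLE) Complex.conjCLE.contDiff.contDiffAt.contMDiffAt hf

variable {M : Type*} [TopologicalSpace M] [ChartedSpace R4 M]
  {S : M → Type*} [TopologicalSpace (TotalSpace C2 S)]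
  [∀ x, AddCommGroup (S x)] [∀ x, TopologicalSpace (S x)] [FiberBundle C2 S]
  [∀ x, Module ℂ (S x)] {x : M}

/-- The field `B` of two-index spinors is complex linear in the first argument, semilinear with
respect to `τ` in the second one, and smooth at `x`. Here `τ` is the identity for fields `B_{AB}`
and complex conjugation for fields `B_{AA'}`; in both cases it fixes the real numbers. -/
structure IsSmoothFieldAt (τ : ℂ →+* ℂ) (B : ∀ y : M, S y → S y → ℂ) (x : M) : Prop where
  real : ∀ r : ℝ, τ r = r
  left : ∀ y d, IsSemilinear (RingHom.id ℂ) fun c => B y c d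
  right : ∀ y c, IsSemilinear τ (B y c)
  smooth : ∀ s t : ∀ y : M, S y, SpinSmoothAt s x → SpinSmoothAt t x →
    FunSmoothAt (fun y => B y (s y) (t y)) x

namespace IsSmoothFieldAt

variable {τ : ℂ →+* ℂ} {B B' : ∀ y : M, S y → S y → ℂ}

theorem add (hB : IsSmoothFieldAt τ B x) (hB' : IsSmoothFieldAt τ B' x) :
    IsSmoothFieldAt τ (fun y c d => B y c d + B' y c d) x where
  real := hB.real
  left y d := (hB.left y d).add_fun (hB'.left y d)
  right y c := (hB.right y c).add_fun (hB'.right y c)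
  smooth s t hs ht := ContMDiffAt.add (hB.smooth s t hs ht) (hB'.smooth s t hs ht)

theorem fun_mul (hB : IsSmoothFieldAt τ B x) {f : M → ℂ} (hf : FunSmoothAt f x) :
    IsSmoothFieldAt τ (fun y c d => f y * B y c d) x where
  real := hB.real
  left y d := (hB.left y d).const_mul (f y)
  right y c := (hB.right y c).const_mul (f y)
  smooth s t hs ht := hf.mul (hB.smooth s t hs ht)

theorem const_mul (hB : IsSmoothFieldAt τ B x) (z : ℂ) :
    IsSmoothFieldAt τ (fun y c d => z * B y c d) x :=
  hB.fun_mul contMDiffAt_const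

theorem swap {B : ∀ y : M, S y → S y → ℂ} (hB : IsSmoothFieldAt (RingHom.id ℂ) B x) :
    IsSmoothFieldAt (RingHom.id ℂ) (fun y c d => B y d c) x where
  real := hB.real
  left y d := hB.right y d
  right y c := hB.left y c
  smooth s t hs ht := hB.smooth t s ht hs

theorem mul_sections {φ ψ : ∀ y : M, S y → S y → ℂ}
    (hφ : IsSmoothFieldAt (RingHom.id ℂ) φ x) (hψ : IsSmoothFieldAt (RingHom.id ℂ) ψ x)
    {s t : ∀ y : M, S y} (hs : SpinSmoothAt s x) (ht : SpinSmoothAt t x) :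
    IsSmoothFieldAt (RingHom.id ℂ) (fun y d f => φ y (s y) d * ψ y (t y) f) x where
  real _ := rfl
  left y f := (hφ.right y (s y)).mul_const (ψ y (t y) f)
  right y d := (hψ.right y (t y)).const_mul (φ y (s y) d)
  smooth u v hu hv := FunSmoothAt.mul (hφ.smooth s u hs hu) (hψ.smooth t v ht hv)

end IsSmoothFieldAt

theorem SymSpinor.isSmoothFieldAt_comp (φ : SymSpinor S) (x : M) :
    IsSmoothFieldAt (RingHom.id ℂ) φ.comp x where
  real _ := rfl
  left _ d := ⟨fun s t => LinearMap.map_add₂ _ s t d, fun z s => LinearMap.map_smul₂ _ z s d⟩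
  right y c := ⟨map_add (φ.val y c), map_smul (φ.val y c)⟩
  smooth := φ.smooth x

variable [∀ x, IsTopologicalAddGroup (S x)] [∀ x, ContinuousSMul ℝ (S x)] [VectorBundle ℝ C2 S]
  [IsManifold (𝓡 4) ∞ M] {nab : CovariantDerivative (𝓡 4) C2 S}

omit [VectorBundle ℝ C2 S] in
theorem mvfderiv_semilinear_parallelExtend {τ : ℂ →+* ℂ} (hτ : ∀ r : ℝ, τ r = r)
    {h : ∀ y : M, S y → ℂ} (hh : ∀ y, IsSemilinear τ (h y))
    (hd : ∀ c : S x, MDifferentiableAt (𝓡 4) 𝓘(ℝ, ℂ) (fun y => h y (extend C2 c y)) x) (c : S x)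
    (v : TangentSpace (𝓡 4) x) :
    mvfderiv (𝓡 4) (fun y => h y (parallelExtend nab c y)) x v
      = mvfderiv (𝓡 4) (fun y => h y (extend C2 c y)) x v - h x (nab (extend C2 c) x v) := by
  set n : Fin 4 → S x := fun j => nab (extend C2 c) x (EuclideanSpace.single j (1 : ℝ))
  have hexpand : (fun y => h y (parallelExtend nab c y)) = fun y => h y (extend C2 c y)
      + ∑ j, (chartCoord x j x - chartCoord x j y) • h y (extend C2 (n j) y) := by
    funext y
    have hmap := map_sum ((hh y).toRealLinearMap hτ)
      (fun j => (chartCoord x j x - chartCoord x j y) • extend C2 (n j) y) Finset.univ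
    simp only [map_smul] at hmap
    exact ((hh y).add _ _).trans (congrArg _ hmap)
  have hterm (j : Fin 4) : MDifferentiableAt (𝓡 4) 𝓘(ℝ, ℂ)
      (fun y => (chartCoord x j x - chartCoord x j y) • h y (extend C2 (n j) y)) x :=
    (mdifferentiableAt_chartCoord_sub j).smul (hd (n j))
  have hderiv (j : Fin 4) : mvfderiv (𝓡 4)
      (fun y => (chartCoord x j x - chartCoord x j y) • h y (extend C2 (n j) y)) x v
        = -(EuclideanSpace.proj (𝕜 := ℝ) j v • h x (n j)) := by
    rw [mvfderiv_fun_smul (mdifferentiableAt_chartCoord_sub j) (hd (n j))]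
    simp only [sub_self, zero_smul, zero_add, extend_apply_self,
      mvfderiv_chartCoord_sub, ContinuousLinearMap.smulRight_apply, neg_smul]
  have hv := linearMap_apply_eq_sum_single
    (((hh x).toRealLinearMap hτ).comp (nab (extend C2 c) x).toLinearMap) v
  rw [hexpand, mvfderiv_fun_add (hd c) (mdifferentiableAt_fun_sum fun j _ => hterm j), add_apply,
    mvfderiv_fun_sum fun j _ => hterm j, sum_apply, Finset.sum_congr rfl fun j _ => hderiv j,
    Finset.sum_neg_distrib, ← sub_eq_add_neg]
  exact congrArg (_ - ·) hv.symm

namespace IsSmoothFieldAt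

variable {τ : ℂ →+* ℂ} {B : ∀ y : M, S y → S y → ℂ}

theorem funSmoothAt_parallelExtend (hB : IsSmoothFieldAt τ B x) (c d : S x) :
    FunSmoothAt (fun y => B y (parallelExtend nab c y) (parallelExtend nab d y)) x :=
  hB.smooth _ _ (spinSmoothAt_parallelExtend c) (spinSmoothAt_parallelExtend d)

theorem mvfderiv_parallelExtend (hB : IsSmoothFieldAt τ B x) (c d : S x)
    (v : TangentSpace (𝓡 4) x) :
    mvfderiv (𝓡 4) (fun y => B y (parallelExtend nab c y) (parallelExtend nab d y)) x v
      = covDeriv nab B x c d v := by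
  have hext (c : S x) : SpinSmoothAt (extend C2 c) x := contMDiffAt_extend (𝓡 4) C2 c
  rw [mvfderiv_semilinear_parallelExtend (fun _ => rfl) (fun y => hB.left y _)
      (fun c => (hB.smooth _ _ (hext c) (spinSmoothAt_parallelExtend d)).mdifferentiableAt),
    mvfderiv_semilinear_parallelExtend hB.real (fun y => hB.right y _)
      (fun d => (hB.smooth _ _ (hext c) (hext d)).mdifferentiableAt), parallelExtend_self,
    extend_apply_self, covDeriv]
  ring

end IsSmoothFieldAt

end Fields

section Derivatives

variable {M : Type*} [TopologicalSpace M] [ChartedSpace R4 M] [IsManifold (𝓡 4) ∞ M]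
  {S : M → Type*} [TopologicalSpace (TotalSpace C2 S)]
  [∀ x, AddCommGroup (S x)] [∀ x, Module ℂ (S x)] [∀ x, TopologicalSpace (S x)]
  [∀ x, IsTopologicalAddGroup (S x)] [∀ x, ContinuousSMul ℝ (S x)]
  [FiberBundle C2 S] [VectorBundle ℂ C2 S] [VectorBundle ℝ C2 S]
  [ContMDiffVectorBundle ∞ C2 S (𝓡 4)]
  {g : LorentzMetric M} {σ : SpinorStructure g S}
  {D : CovariantDerivative (𝓡 4) R4 (TangentSpace (𝓡 4) : M → Type _)}
  {nab : CovariantDerivative (𝓡 4) C2 S} {x : M} {f k : M → ℂ}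

namespace SpinorStructure

theorem twist00_isSemilinear_left (f : M → ℂ) (x : M) (a' : S x) :
    IsSemilinear (RingHom.id ℂ) fun a => σ.twist00 f x a a' :=
  spinorForm_isSemilinear_left (σ.vecRe x) (mvfderiv (𝓡 4) f x).toLinearMap a'

theorem twist00_isSemilinear_right (f : M → ℂ) (x : M) (a : S x) :
    IsSemilinear (starRingEnd ℂ) fun a' => σ.twist00 f x a a' :=
  spinorForm_isSemilinear_right (σ.vecRe x) (mvfderiv (𝓡 4) f x).toLinearMap (σ.vecRe_I x) a

theorem isSmoothFieldAt_twist00 (hf : FunSmoothAt f x) :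
    IsSmoothFieldAt (starRingEnd ℂ) (σ.twist00 f) x where
  real := Complex.conj_ofReal
  left y d := twist00_isSemilinear_left f y d
  right y c := twist00_isSemilinear_right f y c
  smooth s t hs ht := by
    have hre := contMDiffAt_mvfderiv_apply hf (σ.vecRe_smooth x s t hs ht) (m := ∞) (by simp)
    have him := contMDiffAt_mvfderiv_apply hf (σ.vecRe_smooth x _ t hs.smul_I ht) (m := ∞) (by simp)
    exact ContMDiffAt.sub hre (FunSmoothAt.mul contMDiffAt_const him)

theorem twist00_congr (h : f =ᶠ[nhds x] k) (a a' : S x) :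
    σ.twist00 f x a a' = σ.twist00 k x a a' := by
  simp only [twist00, mvfderiv_congr h]

theorem twist00_add (hf : FunSmoothAt f x) (hk : FunSmoothAt k x) (a a' : S x) :
    σ.twist00 (fun y => f y + k y) x a a' = σ.twist00 f x a a' + σ.twist00 k x a a' := by
  simp only [twist00, spinorForm, mvfderiv_fun_add hf.mdifferentiableAt hk.mdifferentiableAt,
    add_apply]
  ring

theorem twist00_sub (hf : FunSmoothAt f x) (hk : FunSmoothAt k x) (a a' : S x) :
    σ.twist00 (fun y => f y - k y) x a a' = σ.twist00 f x a a' - σ.twist00 k x a a' := by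
  simp only [twist00, spinorForm, mvfderiv_fun_sub hf.mdifferentiableAt hk.mdifferentiableAt,
    sub_apply]
  ring

theorem twist00_mul (hf : FunSmoothAt f x) (hk : FunSmoothAt k x) (a a' : S x) :
    σ.twist00 (fun y => f y * k y) x a a'
      = σ.twist00 f x a a' * k x + f x * σ.twist00 k x a a' := by
  simp only [twist00, spinorForm,
    mvfderiv_mul_apply hf.mdifferentiableAt hk.mdifferentiableAt]
  ring

theorem twist00_sum {ι : Type} {A : Finset ι} {f : ι → M → ℂ}
    (hf : ∀ i ∈ A, FunSmoothAt (f i) x) (a a' : S x) :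
    σ.twist00 (fun y => ∑ i ∈ A, f i y) x a a' = ∑ i ∈ A, σ.twist00 (f i) x a a' := by
  simp only [twist00, spinorForm, mvfderiv_fun_sum fun i hi => (hf i hi).mdifferentiableAt,
    sum_apply, Finset.sum_sub_distrib, Finset.mul_sum]

theorem twist00_comp {L : ℂ → ℂ} {L' : ℂ} (hL : HasDerivAt L L' (f x)) (hf : FunSmoothAt f x)
    (a a' : S x) : σ.twist00 (fun y => L (f y)) x a a' = L' * σ.twist00 f x a a' := by
  have hLR := hL.hasFDerivAt.restrictScalars ℝ
  have h (v : TangentSpace (𝓡 4) x) :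
      mvfderiv (𝓡 4) (fun y => L (f y)) x v = mvfderiv (𝓡 4) f x v * L' := by
    rw [mvfderiv_comp_differentiableAt hLR.differentiableAt hf.mdifferentiableAt, hLR.fderiv]
    rfl
  simp only [twist00, spinorForm, h]
  ring

theorem twist00_const_mul (z : ℂ) (hf : FunSmoothAt f x) (a a' : S x) :
    σ.twist00 (fun y => z * f y) x a a' = z * σ.twist00 f x a a' :=
  σ.twist00_comp (by simpa using (hasDerivAt_id (f x)).const_mul z) hf a a'

theorem twist00_conj (hf : FunSmoothAt f x) (a a' : S x) :
    σ.twist00 (fun y => conj (f y)) x a a' = conj (σ.twist00 f x a' a) := by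
  have h (v : TangentSpace (𝓡 4) x) :
      mvfderiv (𝓡 4) (fun y => conj (f y)) x v = conj (mvfderiv (𝓡 4) f x v) := by
    have hc := (Complex.conjCLE : ℂ →L[ℝ] ℂ).hasFDerivAt (x := f x)
    have h := mvfderiv_comp_differentiableAt hc.differentiableAt hf.mdifferentiableAt v
    rwa [hc.fderiv] at h
  have hI : σ.vecRe x (Complex.I • a) a' = -σ.vecRe x (Complex.I • a') a := by
    rw [← σ.vecRe_I x (Complex.I • a), I_smul_I_smul, map_neg, LinearMap.neg_apply, σ.vecRe_symm]
  simp only [twist00, spinorForm, h, hI, σ.vecRe_symm x a a', map_neg, map_sub, map_mul,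
    Complex.conj_I]
  ring

end SpinorStructure

variable {τ : ℂ →+* ℂ} {B B' : ∀ y : M, S y → S y → ℂ}

namespace IsSmoothFieldAt

theorem twist00_parallelExtend (hB : IsSmoothFieldAt τ B x) (a a' c d : S x) :
    σ.twist00 (fun y => B y (parallelExtend nab c y) (parallelExtend nab d y)) x a a'
      = σ.del nab B x a a' c d := by
  simp only [SpinorStructure.twist00, SpinorStructure.del, hB.mvfderiv_parallelExtend]

theorem del_add (hB : IsSmoothFieldAt τ B x) (hB' : IsSmoothFieldAt τ B' x) (a a' c d : S x) :
    σ.del nab (fun y s t => B y s t + B' y s t) x a a' c d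
      = σ.del nab B x a a' c d + σ.del nab B' x a a' c d := by
  simp only [← (hB.add hB').twist00_parallelExtend, ← hB.twist00_parallelExtend,
    ← hB'.twist00_parallelExtend]
  exact σ.twist00_add (hB.funSmoothAt_parallelExtend c d) (hB'.funSmoothAt_parallelExtend c d) a a'

theorem del_fun_mul (hB : IsSmoothFieldAt τ B x) (hf : FunSmoothAt f x) (a a' c d : S x) :
    σ.del nab (fun y s t => f y * B y s t) x a a' c d
      = σ.twist00 f x a a' * B x c d + f x * σ.del nab B x a a' c d := by
  rw [← (hB.fun_mul hf).twist00_parallelExtend, ← hB.twist00_parallelExtend,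
    σ.twist00_mul hf (hB.funSmoothAt_parallelExtend c d)]
  simp only [parallelExtend_self]

theorem del_const_mul (hB : IsSmoothFieldAt τ B x) (z : ℂ) (a a' c d : S x) :
    σ.del nab (fun y s t => z * B y s t) x a a' c d = z * σ.del nab B x a a' c d := by
  rw [← (hB.const_mul z).twist00_parallelExtend, ← hB.twist00_parallelExtend,
    σ.twist00_const_mul z (hB.funSmoothAt_parallelExtend c d)]

theorem del_comm_of_symm (hB : IsSmoothFieldAt τ B x) (hs : ∀ y s t, B y s t = B y t s)
    (a a' c d : S x) : σ.del nab B x a a' c d = σ.del nab B x a a' d c := by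
  simp only [← hB.twist00_parallelExtend]
  exact σ.twist00_congr (.of_forall fun y => hs y _ _) a a'

theorem del_isSemilinear₁ (hB : IsSmoothFieldAt τ B x) (a' c d : S x) :
    IsSemilinear (RingHom.id ℂ) fun a => σ.del nab B x a a' c d := by
  simp only [← hB.twist00_parallelExtend]
  exact σ.twist00_isSemilinear_left _ x a'

theorem del_isSemilinear₂ (hB : IsSmoothFieldAt τ B x) (a c d : S x) :
    IsSemilinear (starRingEnd ℂ) fun a' => σ.del nab B x a a' c d := by
  simp only [← hB.twist00_parallelExtend]
  exact σ.twist00_isSemilinear_right _ x a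

end IsSmoothFieldAt

namespace IsSpinConnection

theorem del_isSemilinear₃ (h : IsSpinConnection σ D nab) (hB : IsSmoothFieldAt τ B x)
    (a a' d : S x) : IsSemilinear (RingHom.id ℂ) fun c => σ.del nab B x a a' c d := by
  refine .of_smul_add fun z s t => ?_
  have hs := hB.funSmoothAt_parallelExtend (nab := nab) s d
  have ht := hB.funSmoothAt_parallelExtend (nab := nab) t d
  have hexpand : (fun y => B y (parallelExtend nab (z • s + t) y) (parallelExtend nab d y))
      =ᶠ[nhds x] fun y => z * B y (parallelExtend nab s y) (parallelExtend nab d y)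
        + B y (parallelExtend nab t y) (parallelExtend nab d y) := by
    filter_upwards [h.eventually_parallelExtend_smul_add z s t] with y hy
    rw [hy, (hB.left y _).add, (hB.left y _).smul, RingHom.id_apply]
  have hz : σ.twist00 (fun y => z * B y (parallelExtend nab s y) (parallelExtend nab d y)) x a a'
      = z * σ.del nab B x a a' s d := by
    rw [← hB.twist00_parallelExtend, σ.twist00_const_mul z hs]
  rw [← hB.twist00_parallelExtend, σ.twist00_congr hexpand,
    σ.twist00_add (FunSmoothAt.mul contMDiffAt_const hs) ht, hz, hB.twist00_parallelExtend,
    RingHom.id_apply]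

theorem twist00_eps_parallelExtend (h : IsSpinConnection σ D nab) (a a' c d : S x) :
    σ.twist00 (fun y => σ.eps y (parallelExtend nab c y) (parallelExtend nab d y)) x a a' = 0 := by
  have hpar (c : S x) := (spinSmoothAt_parallelExtend (nab := nab) c).spinDiffAt
  simp only [SpinorStructure.twist00, spinorForm, h.eps_parallel x _ _ _ (hpar c) (hpar d),
    nab_parallelExtend, map_zero, LinearMap.zero_apply, mul_zero, add_zero, sub_zero]

end IsSpinConnection

end Derivatives

section Hessian

open VectorField

variable {M : Type*} [TopologicalSpace M] [ChartedSpace R4 M] [IsManifold (𝓡 4) ∞ M]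
  {D : CovariantDerivative (𝓡 4) R4 (TangentSpace (𝓡 4) : M → Type _)} {x : M} {f : M → ℂ}

theorem mvfderiv_mvfderiv_comm_of_parallel (hD : D.torsion = 0) (hf : FunSmoothAt f x)
    {V W : ∀ y : M, TangentSpace (𝓡 4) y} (hV : VecSmoothAt V x) (hW : VecSmoothAt W x)
    (hDV : ∀ v, D V x v = 0) (hDW : ∀ v, D W x v = 0) :
    mvfderiv (𝓡 4) (fun y => mvfderiv (𝓡 4) f y (W y)) x (V x)
      = mvfderiv (𝓡 4) (fun y => mvfderiv (𝓡 4) f y (V y)) x (W x) := by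
  have hdiff {X : ∀ y : M, TangentSpace (𝓡 4) y} (hX : VecSmoothAt X x) : VecDiffAt X x :=
    ContMDiffAt.mdifferentiableAt hX (by simp)
  have htorsion := D.torsion_apply (hdiff hV) (hdiff hW)
  rw [hD, hDV, hDW, sub_zero, zero_sub] at htorsion
  have hbracket : mlieBracket (𝓡 4) V W x = 0 := neg_eq_zero.1 htorsion.symm
  have h := mvfderiv_mlieBracket (hf.of_le ENat.LEInfty.out) (hV.of_le (by simp))
    (hW.of_le (by simp))
  rw [hbracket, map_zero] at h
  exact sub_eq_zero.1 h.symm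

variable {S : M → Type*} [TopologicalSpace (TotalSpace C2 S)]
  [∀ x, AddCommGroup (S x)] [∀ x, Module ℂ (S x)] [∀ x, TopologicalSpace (S x)]
  [∀ x, IsTopologicalAddGroup (S x)] [∀ x, ContinuousSMul ℝ (S x)]
  [FiberBundle C2 S] [VectorBundle ℂ C2 S] [VectorBundle ℝ C2 S]
  [ContMDiffVectorBundle ∞ C2 S (𝓡 4)]
  {g : LorentzMetric M} {σ : SpinorStructure g S} {nab : CovariantDerivative (𝓡 4) C2 S}

theorem IsSpinConnection.connection_vecRe_eq_zero (h : IsSpinConnection σ D nab)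
    {s t : ∀ y : M, S y} (hs : SpinSmoothAt s x) (ht : SpinSmoothAt t x) (hs0 : ∀ v, nab s x v = 0)
    (ht0 : ∀ v, nab t x v = 0) (v : TangentSpace (𝓡 4) x) :
    D (fun y => σ.vecRe y (s y) (t y)) x v = 0 := by
  rw [h.vecRe_parallel x s t v hs.spinDiffAt ht.spinDiffAt, hs0, ht0, map_zero, map_zero,
    LinearMap.zero_apply, add_zero]

theorem SpinorStructure.del_twist00 (hf : FunSmoothAt f x) (a a' b b' : S x) :
    σ.del nab (σ.twist00 f) x a a' b b'
      = σ.twist00 (fun y => mvfderiv (𝓡 4) f y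
          (σ.vecRe y (parallelExtend nab b y) (parallelExtend nab b' y))) x a a'
        - Complex.I * σ.twist00 (fun y => mvfderiv (𝓡 4) f y
          (σ.vecRe y (Complex.I • parallelExtend nab b y) (parallelExtend nab b' y))) x a a' := by
  have hsmooth {s t : ∀ y : M, S y} (hs : SpinSmoothAt s x) (ht : SpinSmoothAt t x) :
      FunSmoothAt (fun y => mvfderiv (𝓡 4) f y (σ.vecRe y (s y) (t y))) x :=
    contMDiffAt_mvfderiv_apply hf (σ.vecRe_smooth x s t hs ht) (by simp)
  have hb := spinSmoothAt_parallelExtend (nab := nab) b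
  have hb' := spinSmoothAt_parallelExtend (nab := nab) b'
  rw [← (σ.isSmoothFieldAt_twist00 hf).twist00_parallelExtend,
    ← σ.twist00_const_mul Complex.I (hsmooth hb.smul_I hb')]
  exact σ.twist00_sub (hsmooth hb hb') (FunSmoothAt.mul contMDiffAt_const (hsmooth hb.smul_I hb'))
    a a'

theorem IsSpinConnection.del_twist00_symm (h : IsSpinConnection σ D nab) (hD : D.torsion = 0)
    (hf : FunSmoothAt f x) (a a' b b' : S x) :
    σ.del nab (σ.twist00 f) x a a' b b' = σ.del nab (σ.twist00 f) x b b' a a' := by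
  let V (c c' : S x) (y : M) := σ.vecRe y (parallelExtend nab c y) (parallelExtend nab c' y)
  let W (c c' : S x) (y : M) :=
    σ.vecRe y (Complex.I • parallelExtend nab c y) (parallelExtend nab c' y)
  have hpar (c : S x) := spinSmoothAt_parallelExtend (nab := nab) c
  have hV (c c' : S x) : VecSmoothAt (V c c') x := σ.vecRe_smooth x _ _ (hpar c) (hpar c')
  have hW (c c' : S x) : VecSmoothAt (W c c') x := σ.vecRe_smooth x _ _ (hpar c).smul_I (hpar c')
  have hDV (c c' : S x) := h.connection_vecRe_eq_zero (hpar c) (hpar c') (nab_parallelExtend c)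
    (nab_parallelExtend c')
  have hI (c : S x) (v) : nab (fun y => Complex.I • parallelExtend nab c y) x v = 0 := by
    rw [h.smul_I x _ v (hpar c).spinDiffAt, nab_parallelExtend, smul_zero]
  have hDW (c c' : S x) := h.connection_vecRe_eq_zero (hpar c).smul_I (hpar c') (hI c)
    (nab_parallelExtend c')
  have hVW := mvfderiv_mvfderiv_comm_of_parallel hD hf (hV a a') (hW b b') (hDV a a') (hDW b b')
  have hWV := mvfderiv_mvfderiv_comm_of_parallel hD hf (hW a a') (hV b b') (hDW a a') (hDV b b')
  have hVV := mvfderiv_mvfderiv_comm_of_parallel hD hf (hV a a') (hV b b') (hDV a a') (hDV b b')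
  have hWW := mvfderiv_mvfderiv_comm_of_parallel hD hf (hW a a') (hW b b') (hDW a a') (hDW b b')
  simp only [V, W, parallelExtend_self] at hVV hVW hWV hWW
  simp only [σ.del_twist00 hf, SpinorStructure.twist00, spinorForm]
  linear_combination hVV - Complex.I * hVW - Complex.I * hWV + Complex.I ^ 2 * hWW

theorem IsSpinConnection.del_comp_mul_twist00_symm (h : IsSpinConnection σ D nab)
    (hD : D.torsion = 0) (hf : FunSmoothAt f x) {L : ℂ → ℂ} {L' : ℂ} (hL : HasDerivAt L L' (f x))
    (hLf : FunSmoothAt (fun y => L (f y)) x) (a a' b b' : S x) :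
    σ.del nab (fun y s t => L (f y) * σ.twist00 f y s t) x a a' b b'
      = σ.del nab (fun y s t => L (f y) * σ.twist00 f y s t) x b b' a a' := by
  simp only [(σ.isSmoothFieldAt_twist00 hf).del_fun_mul hLf, σ.twist00_comp hL hf]
  rw [h.del_twist00_symm hD hf a a' b b']
  ring

end Hessian

section Contraction

variable {M : Type*} [TopologicalSpace M] [ChartedSpace R4 M] [IsManifold (𝓡 4) ∞ M]
  {S : M → Type*} [TopologicalSpace (TotalSpace C2 S)]
  [∀ x, AddCommGroup (S x)] [∀ x, Module ℂ (S x)] [∀ x, TopologicalSpace (S x)]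
  [∀ x, IsTopologicalAddGroup (S x)] [∀ x, ContinuousSMul ℝ (S x)]
  [FiberBundle C2 S] [VectorBundle ℂ C2 S] [VectorBundle ℝ C2 S]
  [ContMDiffVectorBundle ∞ C2 S (𝓡 4)]
  {g : LorentzMetric M} {σ : SpinorStructure g S} {x : M} {τ : ℂ →+* ℂ}

theorem SpinorStructure.eps_swap (σ : SpinorStructure g S) (x : M) (s t : S x) :
    σ.eps x t s = -σ.eps x s t :=
  ((show (σ.eps x).IsAlt from σ.eps_alt x).neg s t).symm

namespace IsSemilinear

variable {h k : S x → ℂ} {o ι : S x}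

theorem eq_frame (hh : IsSemilinear τ h) (he : σ.eps x o ι = 1) (v : S x) :
    h v = τ (σ.eps x v ι) * h o + τ (σ.eps x o v) * h ι := by
  conv_lhs => rw [σ.eq_frame x he v, hh.add, hh.smul, hh.smul]

theorem ext_frame (hh : IsSemilinear τ h) (hk : IsSemilinear τ k) (he : σ.eps x o ι = 1)
    (ho : h o = k o) (hι : h ι = k ι) (v : S x) : h v = k v := by
  rw [hh.eq_frame he, hk.eq_frame he, ho, hι]

end IsSemilinear

namespace SpinorStructure

theorem sub_swap_eq_up_mul_eps {B : S x → S x → ℂ}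
    (hl : ∀ t, IsSemilinear τ fun s => B s t) (hr : ∀ s, IsSemilinear τ (B s)) (s t : S x) :
    B s t - B t s = σ.up x B * τ (σ.eps x s t) := by
  have he := σ.eps_frame x
  have hs := (hl t).eq_frame he s
  have hs' := (hr t).eq_frame he s
  have ht (u) := (hr u).eq_frame he t
  have ht' (u) := (hl u).eq_frame he t
  have hε := congrArg (σ.eps x · t) (σ.eq_frame x he s)
  simp only [map_add, map_smul, LinearMap.add_apply, LinearMap.smul_apply, smul_eq_mul] at hε
  have hιt := σ.eps_swap x t (σ.frameI x)
  rw [hs, hs', ht, ht, ht', ht', hε, hιt, up]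
  simp only [map_add, map_mul, map_neg]
  ring

end SpinorStructure

variable {φ ψ C : ∀ y : M, S y → S y → ℂ}

variable {D : CovariantDerivative (𝓡 4) R4 (TangentSpace (𝓡 4) : M → Type _)}
  {nab : CovariantDerivative (𝓡 4) C2 S}

namespace IsSmoothFieldAt

theorem up_mul_eps (hC : IsSmoothFieldAt (RingHom.id ℂ) C x) (y : M) (s t : S y) :
    σ.up y (C y) * σ.eps y s t = C y s t - C y t s :=
  (σ.sub_swap_eq_up_mul_eps (hC.left y) (hC.right y) s t).symm

theorem funSmoothAt_up (hC : IsSmoothFieldAt (RingHom.id ℂ) C x) :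
    FunSmoothAt (fun y => σ.up y (C y)) x := by
  -- The chosen frame need not be smooth in `y`, so `σ.up` is recovered from a smooth pair of
  -- sections instead, dividing by their `σ.eps`.
  have hext (c : S x) : SpinSmoothAt (extend C2 c) x := contMDiffAt_extend (𝓡 4) C2 c
  have ho := hext (σ.frameO x)
  have hι := hext (σ.frameI x)
  refine .of_mul (k := fun y => σ.eps y (extend C2 (σ.frameO x) y) (extend C2 (σ.frameI x) y)) ?_
    (σ.eps_smooth x _ _ ho hι) ?_
  · simp only [hC.up_mul_eps]
    exact ContMDiffAt.sub (hC.smooth _ _ ho hι) (hC.smooth _ _ hι ho)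
  · simp only [extend_apply_self, σ.eps_frame]
    exact one_ne_zero

theorem twist00_up (h : IsSpinConnection σ D nab) (hC : IsSmoothFieldAt (RingHom.id ℂ) C x)
    (a a' : S x) :
    σ.twist00 (fun y => σ.up y (C y)) x a a' = σ.up x (σ.del nab C x a a') := by
  have hpar (c : S x) := spinSmoothAt_parallelExtend (nab := nab) c
  have ho := hpar (σ.frameO x)
  have hι := hpar (σ.frameI x)
  have hmul := σ.twist00_mul (hC.funSmoothAt_up (σ := σ)) (σ.eps_smooth x _ _ ho hι) a a'
  have hsub := σ.twist00_sub (hC.smooth _ _ ho hι) (hC.smooth _ _ hι ho) a a'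
  simp only [hC.up_mul_eps, parallelExtend_self, σ.eps_frame, mul_one,
    h.twist00_eps_parallelExtend, mul_zero, add_zero] at hmul
  rw [← hmul, hsub, hC.twist00_parallelExtend, hC.twist00_parallelExtend, SpinorStructure.up]

end IsSmoothFieldAt

namespace SpinorStructure

variable (σ) in
/-- The contraction `φ_{AD} ψ_B^D` of two spinor fields of valence `(2,0)`. -/
def contract (φ ψ : ∀ y : M, S y → S y → ℂ) (y : M) (a b : S y) : ℂ :=
  σ.up y fun d f => φ y a d * ψ y b f

end SpinorStructure

namespace IsSmoothFieldAt

variable (hφ : IsSmoothFieldAt (RingHom.id ℂ) φ x) (hψ : IsSmoothFieldAt (RingHom.id ℂ) ψ x)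
include hφ hψ

theorem contract : IsSmoothFieldAt (RingHom.id ℂ) (σ.contract φ ψ) x where
  real _ := rfl
  left y b := .of_smul_add fun z s t => by
    simp only [SpinorStructure.contract, SpinorStructure.up, (hφ.left y _).add, (hφ.left y _).smul]
    ring
  right y a := .of_smul_add fun z s t => by
    simp only [SpinorStructure.contract, SpinorStructure.up, (hψ.left y _).add, (hψ.left y _).smul]
    ring
  smooth _ _ hs ht := (hφ.mul_sections hψ hs ht).funSmoothAt_up

theorem del_contract (h : IsSpinConnection σ D nab) (a a' b c : S x) :
    σ.del nab (σ.contract φ ψ) x a a' b c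
      = σ.up x fun d f => σ.del nab φ x a a' b d * ψ x c f + φ x b d * σ.del nab ψ x a a' c f := by
  have hmul := hφ.mul_sections hψ (spinSmoothAt_parallelExtend (nab := nab) b)
    (spinSmoothAt_parallelExtend (nab := nab) c)
  rw [← (hφ.contract hψ).twist00_parallelExtend]
  simp only [SpinorStructure.contract]
  rw [hmul.twist00_up h]
  congr 1
  funext d f
  rw [← hmul.twist00_parallelExtend, ← hφ.twist00_parallelExtend, ← hψ.twist00_parallelExtend,
    σ.twist00_mul (hφ.funSmoothAt_parallelExtend b d) (hψ.funSmoothAt_parallelExtend c f)]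
  simp only [parallelExtend_self]

theorem funSmoothAt_inner20 : FunSmoothAt (σ.inner20 φ ψ) x :=
  (hφ.contract hψ).funSmoothAt_up

theorem twist00_inner20 (h : IsSpinConnection σ D nab) (a a' : S x) :
    σ.twist00 (σ.inner20 φ ψ) x a a'
      = σ.up x fun b c => σ.up x fun d f =>
        σ.del nab φ x a a' b d * ψ x c f + φ x b d * σ.del nab ψ x a a' c f := by
  simp only [← hφ.del_contract hψ h]
  exact (hφ.contract hψ).twist00_up h a a'

end IsSmoothFieldAt

end Contraction

section KillingSpinors

variable {M : Type*} [TopologicalSpace M] [ChartedSpace R4 M] [IsManifold (𝓡 4) ∞ M]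
  {S : M → Type*} [TopologicalSpace (TotalSpace C2 S)]
  [∀ x, AddCommGroup (S x)] [∀ x, Module ℂ (S x)] [∀ x, TopologicalSpace (S x)]
  [∀ x, IsTopologicalAddGroup (S x)] [∀ x, ContinuousSMul ℝ (S x)]
  [FiberBundle C2 S] [VectorBundle ℂ C2 S] [VectorBundle ℝ C2 S]
  [ContMDiffVectorBundle ∞ C2 S (𝓡 4)]
  {g : LorentzMetric M} {σ : SpinorStructure g S}
  {D : CovariantDerivative (𝓡 4) R4 (TangentSpace (𝓡 4) : M → Type _)}
  {nab : CovariantDerivative (𝓡 4) C2 S} {κ φ : SymSpinor S} {x : M}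

namespace SpinorStructure

theorem del_comp_comm (φ : SymSpinor S) (a a' b c : S x) :
    σ.del nab φ.comp x a a' b c = σ.del nab φ.comp x a a' c b :=
  (φ.isSmoothFieldAt_comp x).del_comm_of_symm φ.symm a a' b c

theorem IsKillingSpinor.exists_del_eq (hκ : σ.IsKillingSpinor nab κ)
    (h : IsSpinConnection σ D nab) (a' : S x) :
    ∃ ξ : S x → ℂ, ∀ a b c,
      σ.del nab κ.comp x a a' b c = σ.eps x a b * ξ c + σ.eps x a c * ξ b := by
  have hκs := κ.isSmoothFieldAt_comp x
  have hswap (a b c : S x) := σ.sub_swap_eq_up_mul_eps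
    (fun t => hκs.del_isSemilinear₁ a' t c) (fun s => h.del_isSemilinear₃ hκs s a' c) a b
  refine ⟨fun c => (1 / 3) * σ.up x fun s t => σ.del nab κ.comp x s a' t c, fun a b c => ?_⟩
  have htwist := hκ x a b c a'
  have hac := hswap a c b
  have hab := hswap a b c
  simp only [twist20, RingHom.id_apply, σ.del_comp_comm κ a a' c b, σ.del_comp_comm κ b a' c a,
    σ.del_comp_comm κ c a' b a] at htwist hac hab
  linear_combination htwist + (1 / 3) * (hab + hac)

theorem IsMaxwell.del_swap (hφ : σ.IsMaxwell nab φ) (h : IsSpinConnection σ D nab)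
    (a a' b c : S x) : σ.del nab φ.comp x a a' b c = σ.del nab φ.comp x b a' a c := by
  have hφs := φ.isSmoothFieldAt_comp x
  have hswap := σ.sub_swap_eq_up_mul_eps
    (fun t => hφs.del_isSemilinear₁ a' t c) (fun s => h.del_isSemilinear₃ hφs s a' c) a b
  have hdiv : (σ.up x fun s t => σ.del nab φ.comp x s a' t c) = 0 := by
    have := hφ x c a'
    simp only [curlDagger20, up, σ.del_comp_comm φ _ a' c] at this ⊢
    linear_combination -this
  rwa [hdiv, zero_mul, sub_eq_zero] at hswap

theorem Theta_eq (κ φ : SymSpinor S) :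
    σ.Theta κ φ = fun y a b =>
      -1 * (σ.contract φ.comp κ.comp y b a + σ.contract φ.comp κ.comp y a b) := by
  funext y a b
  simp only [Theta, contract, up]
  ring

theorem Theta_comm (κ φ : SymSpinor S) (y : M) (a b : S y) :
    σ.Theta κ φ y a b = σ.Theta κ φ y b a := by
  simp only [Theta_eq, add_comm]

theorem isSmoothFieldAt_Theta (κ φ : SymSpinor S) (x : M) :
    IsSmoothFieldAt (RingHom.id ℂ) (σ.Theta κ φ) x := by
  have hφκ := (φ.isSmoothFieldAt_comp x).contract (σ := σ) (κ.isSmoothFieldAt_comp x)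
  rw [Theta_eq]
  exact (hφκ.swap.add hφκ).const_mul (-1)

theorem del_Theta (h : IsSpinConnection σ D nab) (a a' b c : S x) :
    σ.del nab (σ.Theta κ φ) x a a' b c
      = -(σ.up x fun d f => σ.del nab φ.comp x a a' c d * κ.comp x b f
          + φ.comp x c d * σ.del nab κ.comp x a a' b f)
        - σ.up x fun d f => σ.del nab φ.comp x a a' b d * κ.comp x c f
          + φ.comp x b d * σ.del nab κ.comp x a a' c f := by
  have hφ := φ.isSmoothFieldAt_comp x
  have hκ := κ.isSmoothFieldAt_comp x
  have hφκ := hφ.contract (σ := σ) hκ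
  have hswap : σ.del nab (fun y b c => σ.contract φ.comp κ.comp y c b) x a a' b c
      = σ.del nab (σ.contract φ.comp κ.comp) x a a' c b := by
    rw [← hφκ.swap.twist00_parallelExtend, ← hφκ.twist00_parallelExtend]
  rw [Theta_eq, (hφκ.swap.add hφκ).del_const_mul, hφκ.swap.del_add hφκ, hswap,
    hφ.del_contract hκ h, hφ.del_contract hκ h]
  ring

theorem U_eq (κ : SymSpinor S) :
    σ.U κ = fun y a a' => -(1 / 2) * (σ.inner20 κ.comp κ.comp y)⁻¹
      * σ.twist00 (σ.inner20 κ.comp κ.comp) y a a' := by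
  have hneg (y : M) (a a' : S y) : σ.twist00 (fun y => -σ.inner20 κ.comp κ.comp y) y a a'
      = -σ.twist00 (σ.inner20 κ.comp κ.comp) y a a' := by
    have hF := (κ.isSmoothFieldAt_comp y).funSmoothAt_inner20 (σ := σ) (κ.isSmoothFieldAt_comp y)
    simpa only [neg_one_mul] using σ.twist00_const_mul (-1) hF a a'
  funext y a a'
  rw [U, hneg, neg_div_neg_eq]
  ring

theorem isSmoothFieldAt_U (hκ : σ.inner20 κ.comp κ.comp x ≠ 0) :
    IsSmoothFieldAt (starRingEnd ℂ) (σ.U κ) x := by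
  have hF := (κ.isSmoothFieldAt_comp x).funSmoothAt_inner20 (σ := σ) (κ.isSmoothFieldAt_comp x)
  rw [U_eq]
  exact (σ.isSmoothFieldAt_twist00 hF).fun_mul (.mul contMDiffAt_const (hF.inv hκ))

theorem del_U_symm (h : IsSpinConnection σ D nab) (hD : D.torsion = 0)
    (hκ : σ.inner20 κ.comp κ.comp x ≠ 0) (a a' b b' : S x) :
    σ.del nab (σ.U κ) x a a' b b' = σ.del nab (σ.U κ) x b b' a a' := by
  have hF := (κ.isSmoothFieldAt_comp x).funSmoothAt_inner20 (σ := σ) (κ.isSmoothFieldAt_comp x)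
  rw [U_eq]
  exact h.del_comp_mul_twist00_symm hD hF ((hasDerivAt_inv hκ).const_mul _)
    (.mul contMDiffAt_const (hF.inv hκ)) a a' b b'

end SpinorStructure

end KillingSpinors

section Beta

variable {M : Type*} [TopologicalSpace M] [ChartedSpace R4 M] [IsManifold (𝓡 4) ∞ M]
  {S : M → Type*} [TopologicalSpace (TotalSpace C2 S)]
  [∀ x, AddCommGroup (S x)] [∀ x, Module ℂ (S x)] [∀ x, TopologicalSpace (S x)]
  [∀ x, IsTopologicalAddGroup (S x)] [∀ x, ContinuousSMul ℝ (S x)]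
  [FiberBundle C2 S] [VectorBundle ℂ C2 S] [VectorBundle ℝ C2 S]
  [ContMDiffVectorBundle ∞ C2 S (𝓡 4)]
  {g : LorentzMetric M} {σ : SpinorStructure g S}
  {D : CovariantDerivative (𝓡 4) R4 (TangentSpace (𝓡 4) : M → Type _)}
  {nab : CovariantDerivative (𝓡 4) C2 S} {κ φ : SymSpinor S} {x : M}
  {U Θ : ∀ y : M, S y → S y → ℂ} {f : M → ℂ}

namespace SpinorStructure

variable (σ nab) in
/-- The divergence `∇^B_{A'} Θ_{AB} + U^B_{A'} Θ_{AB}` twisted by the covector field `U`. -/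
def twistedDiv (U Θ : ∀ y : M, S y → S y → ℂ) (x : M) (a a' : S x) : ℂ :=
  σ.curlDagger20 nab Θ x a a' + σ.up x fun b c => U x c a' * Θ x a b

variable (σ) in
/-- The gradient `∇_{AA'} f + z f U_{AA'}` twisted by the multiple `z U` of a covector field. -/
def twistedGrad (z : ℂ) (U : ∀ y : M, S y → S y → ℂ) (f : M → ℂ) (x : M) (a a' : S x) : ℂ :=
  z * (f x * U x a a') + σ.twist00 f x a a'

theorem twistedDiv_isSemilinear_left (h : IsSpinConnection σ D nab)
    (hΘ : IsSmoothFieldAt (RingHom.id ℂ) Θ x) (a' : S x) :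
    IsSemilinear (RingHom.id ℂ) fun a => σ.twistedDiv nab U Θ x a a' :=
  .of_smul_add fun z s t => by
    have hdel (a b : S x) := h.del_isSemilinear₃ hΘ a a' b
    have hΘl (b : S x) := hΘ.left x b
    simp only [twistedDiv, curlDagger20, up, (hdel _ _).add, (hdel _ _).smul, (hΘl _).add,
      (hΘl _).smul]
    ring

theorem isSmoothFieldAt_twistedGrad (z : ℂ) (hU : IsSmoothFieldAt (starRingEnd ℂ) U x)
    (hf : FunSmoothAt f x) : IsSmoothFieldAt (starRingEnd ℂ) (σ.twistedGrad z U f) x :=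
  ((hU.fun_mul hf).const_mul z).add (σ.isSmoothFieldAt_twist00 hf)

theorem del_twistedGrad_sub_swap (h : IsSpinConnection σ D nab) (hD : D.torsion = 0)
    (hU : IsSmoothFieldAt (starRingEnd ℂ) U x)
    (hUc : ∀ a a' b b', σ.del nab U x a a' b b' = σ.del nab U x b b' a a')
    (hf : FunSmoothAt f x) (z : ℂ) (a a' b b' : S x) :
    σ.del nab (σ.twistedGrad z U f) x a a' b b' - σ.del nab (σ.twistedGrad z U f) x b b' a a'
      = z * (σ.twistedGrad z U f x a a' * U x b b' - σ.twistedGrad z U f x b b' * U x a a') := by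
  have hdel (a a' b b') : σ.del nab (σ.twistedGrad z U f) x a a' b b'
      = z * (σ.twist00 f x a a' * U x b b' + f x * σ.del nab U x a a' b b')
        + σ.del nab (σ.twist00 f) x a a' b b' := by
    rw [← hU.del_fun_mul hf, ← (hU.fun_mul hf).del_const_mul,
      ← ((hU.fun_mul hf).const_mul z).del_add (σ.isSmoothFieldAt_twist00 hf)]
    rfl
  rw [hdel, hdel, hUc a, h.del_twist00_symm hD hf a, twistedGrad, twistedGrad]
  ring

variable {β : ∀ y : M, S y → S y → ℂ}

theorem curl11_eq_of_sub_swap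
    (hβ : ∀ a a' b b', σ.del nab β x a a' b b' - σ.del nab β x b b' a a'
      = -1 * (β x a a' * U x b b' - β x b b' * U x a a')) (a b : S x) :
    σ.curl11 nab β x a b
      = (1 / 2) * ((σ.up x fun a' b' => U x a b' * β x b a')
        + σ.up x fun a' b' => U x b b' * β x a a') := by
  simp only [curl11, up]
  linear_combination (1 / 2) * (hβ a (σ.frameI x) b (σ.frameO x)
    + hβ b (σ.frameI x) a (σ.frameO x))

theorem curlDagger11_eq_of_sub_swap
    (hβ : ∀ a a' b b', σ.del nab β x a a' b b' - σ.del nab β x b b' a a'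
      = -1 * (β x a a' * U x b b' - β x b b' * U x a a')) (a' b' : S x) :
    σ.curlDagger11 nab β x a' b'
      = (1 / 2) * ((σ.up x fun a b => U x b a' * β x a b')
        + σ.up x fun a b => U x b b' * β x a a') := by
  simp only [curlDagger11, up]
  linear_combination (1 / 2) * (hβ (σ.frameI x) a' (σ.frameO x) b'
    + hβ (σ.frameI x) b' (σ.frameO x) a')

theorem inner20_comp_self (κ : SymSpinor S) (x : M) :
    σ.inner20 κ.comp κ.comp x
      = 2 * (κ.comp x (σ.frameO x) (σ.frameO x) * κ.comp x (σ.frameI x) (σ.frameI x)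
        - κ.comp x (σ.frameO x) (σ.frameI x) ^ 2) := by
  have hsymm : κ.comp x (σ.frameI x) (σ.frameO x) = κ.comp x (σ.frameO x) (σ.frameI x) :=
    κ.symm x _ _
  simp only [inner20, up, hsymm]
  ring

theorem twistedDiv_Theta (h : IsSpinConnection σ D nab) (hκ : σ.IsKillingSpinor nab κ)
    (hκ0 : σ.inner20 κ.comp κ.comp x ≠ 0) (hφ : σ.IsMaxwell nab φ) (a a' : S x) :
    σ.twistedDiv nab (σ.U κ) (σ.Theta κ φ) x a a'
      = σ.twistedGrad (-1) (σ.U κ) (σ.Upsilon κ φ) x a a' := by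
  have he := σ.eps_frame x
  have hκs := κ.isSmoothFieldAt_comp x
  have hφs := φ.isSmoothFieldAt_comp x
  have hΥ : FunSmoothAt (σ.Upsilon κ φ) x := hφs.funSmoothAt_inner20 hκs
  have hΥ' : σ.Upsilon κ φ = σ.inner20 φ.comp κ.comp := rfl
  have hleft := σ.twistedDiv_isSemilinear_left (U := σ.U κ) h (σ.isSmoothFieldAt_Theta κ φ x) a'
  have hright := (σ.isSmoothFieldAt_twistedGrad (-1) (σ.isSmoothFieldAt_U hκ0) hΥ).left x a'
  obtain ⟨ξ, hξ⟩ := hκ.exists_del_eq h a'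
  have hιo : σ.eps x (σ.frameI x) (σ.frameO x) = -1 := by rw [σ.eps_swap, he]
  have hκc : κ.comp x (σ.frameI x) (σ.frameO x) = κ.comp x (σ.frameO x) (σ.frameI x) :=
    κ.symm x _ _
  have hφc : φ.comp x (σ.frameI x) (σ.frameO x) = φ.comp x (σ.frameO x) (σ.frameI x) :=
    φ.symm x _ _
  have hoι (a) := σ.del_comp_comm (nab := nab) φ a a' (σ.frameI x) (σ.frameO x)
  have hswapo := hφ.del_swap h (σ.frameI x) a' (σ.frameO x) (σ.frameO x)
  have hswapι := hφ.del_swap h (σ.frameI x) a' (σ.frameO x) (σ.frameI x)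
  rw [hoι] at hswapo
  rw [inner20_comp_self] at hκ0
  have hinv := mul_inv_cancel₀ hκ0
  refine hleft.ext_frame hright he ?_ ?_ a <;>
    simp only [twistedDiv, twistedGrad, curlDagger20, del_Theta h, U_eq, hΥ',
      hφs.twist00_inner20 hκs h, hκs.twist00_inner20 hκs h, inner20_comp_self] <;>
    simp only [inner20, Theta_eq, contract, hξ, up, he, hιo, σ.eps_alt, hκc, hφc, hoι, hswapo,
      hswapι]
  · linear_combination 2 * (ξ (σ.frameO x) * φ.comp x (σ.frameO x) (σ.frameI x)
      - ξ (σ.frameI x) * φ.comp x (σ.frameO x) (σ.frameO x)) * hinv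
  · linear_combination 2 * (ξ (σ.frameO x) * φ.comp x (σ.frameI x) (σ.frameI x)
      - ξ (σ.frameI x) * φ.comp x (σ.frameO x) (σ.frameI x)) * hinv

end SpinorStructure

end Beta

section Wedge

variable {V : Type*}

/-- The wedge product of two covectors, each a function `p a a'` of a pair of spinor indices. -/
def wedge₂ (p q : V → V → ℂ) (a a' b b' : V) : ℂ :=
  p a a' * q b b' - q a a' * p b b'

/-- The wedge product of three covectors, each a function `p a a'` of a pair of spinor indices. -/
def wedge₃ (P p q : V → V → ℂ) (a a' b b' c c' : V) : ℂ :=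
  P a a' * wedge₂ p q b b' c c' + P b b' * wedge₂ p q c c' a a' + P c c' * wedge₂ p q a a' b b'

/-- The alternation of a function of a covector argument and three skew covector arguments. -/
def alternate₄ (F : V → V → V → V → V → V → V → V → ℂ) (a a' b b' c c' d d' : V) : ℂ :=
  F a a' b b' c c' d d' - F b b' a a' c c' d d' + F c c' a a' b b' d d' - F d d' a a' b b' c c'

theorem alternate₄_sum {J : Type*} [Fintype J] (F : J → V → V → V → V → V → V → V → V → ℂ)
    (a a' b b' c c' d d' : V) :
    alternate₄ (fun a a' b b' c c' d d' => ∑ j, F j a a' b b' c c' d d') a a' b b' c c' d d'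
      = ∑ j, alternate₄ (F j) a a' b b' c c' d d' := by
  simp only [alternate₄, Finset.sum_add_distrib, Finset.sum_sub_distrib]

theorem alternate₄_wedge₃_eq_zero {P p q U : V → V → ℂ} {DP Dp Dq : V → V → V → V → ℂ}
    (hP : ∀ a a' b b', DP a a' b b' - DP b b' a a' = P a a' * U b b' - P b b' * U a a')
    (hp : ∀ a a' b b', Dp a a' b b' = Dp b b' a a')
    (hq : ∀ a a' b b', Dq a a' b b' = Dq b b' a a') (a a' b b' c c' d d' : V) :
    alternate₄ (fun a a' b b' c c' d d' => wedge₃ (DP a a') p q b b' c c' d d'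
      + wedge₃ P (Dp a a') q b b' c c' d d' + wedge₃ P p (Dq a a') b b' c c' d d'
      + U a a' * wedge₃ P p q b b' c c' d d') a a' b b' c c' d d' = 0 := by
  simp only [alternate₄, wedge₃, wedge₂]
  rw [hp b b' a, hp c c' a, hp d d' a, hp c c' b, hp d d' b, hp d d' c, hq b b' a, hq c c' a,
    hq d d' a, hq c c' b, hq d d' b, hq d d' c]
  linear_combination (norm := (simp only [wedge₂]; ring))
    hP a a' b b' * wedge₂ p q c c' d d' - hP a a' c c' * wedge₂ p q b b' d d'
      + hP a a' d d' * wedge₂ p q b b' c c' + hP b b' c c' * wedge₂ p q a a' d d'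
      - hP b b' d d' * wedge₂ p q a a' c c' + hP c c' d d' * wedge₂ p q a a' b b'

end Wedge

section TwoForm

variable {M : Type*} [TopologicalSpace M] [ChartedSpace R4 M] [IsManifold (𝓡 4) ∞ M]
  {S : M → Type*} [TopologicalSpace (TotalSpace C2 S)]
  [∀ x, AddCommGroup (S x)] [∀ x, Module ℂ (S x)] [∀ x, TopologicalSpace (S x)]
  [∀ x, IsTopologicalAddGroup (S x)] [∀ x, ContinuousSMul ℝ (S x)]
  [FiberBundle C2 S] [VectorBundle ℂ C2 S] [VectorBundle ℝ C2 S]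
  [ContMDiffVectorBundle ∞ C2 S (𝓡 4)]
  {g : LorentzMetric M} {σ : SpinorStructure g S}
  {D : CovariantDerivative (𝓡 4) R4 (TangentSpace (𝓡 4) : M → Type _)}
  {nab : CovariantDerivative (𝓡 4) C2 S} {x : M}

theorem IsSemilinear.schouten {τ : ℂ →+* ℂ} {h : S x → ℂ} (hh : IsSemilinear τ h) (s t u : S x) :
    τ (σ.eps x s t) * h u + τ (σ.eps x t u) * h s + τ (σ.eps x u s) * h t = 0 := by
  have hε : IsSemilinear τ fun v => τ (σ.eps x u v) :=
    ⟨fun v w => by rw [map_add, map_add], fun z v => by rw [map_smul, smul_eq_mul, map_mul]⟩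
  have hswap := σ.sub_swap_eq_up_mul_eps (B := fun v w => τ (σ.eps x u v) * h w)
    (fun w => hε.mul_const (h w)) (fun v => hh.const_mul _) s t
  have hu := hh.eq_frame (σ.eps_frame x) u
  rw [SpinorStructure.up] at hswap
  rw [σ.eps_swap x u (σ.frameO x), map_neg] at hu
  rw [σ.eps_swap x u t, map_neg]
  linear_combination hswap + τ (σ.eps x s t) * hu

namespace SpinorStructure

variable (σ) in
/-- The three-form dual to a covector `β`, as a function of three covector arguments. -/
def hodgeDual (x : M) (β : S x → S x → ℂ) (a a' b b' c c' : S x) : ℂ :=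
  conj (σ.eps x b' c') * σ.eps x c a * β b a' + conj (σ.eps x c' a') * σ.eps x c b * β a b'

variable {Θ U : ∀ y : M, S y → S y → ℂ}

/-- The exterior derivative, twisted by `U`, of the two-form `Θ_{BC} ε̄_{B'C'}` is the dual of the
twisted divergence of `Θ`. -/
theorem hodgeDual_twistedDiv (h : IsSpinConnection σ D nab)
    (hΘ : IsSmoothFieldAt (RingHom.id ℂ) Θ x) (hΘc : ∀ y a b, Θ y a b = Θ y b a)
    (hU : IsSmoothFieldAt (starRingEnd ℂ) U x) (a a' b b' c c' : S x) :
    σ.hodgeDual x (σ.twistedDiv nab U Θ x) a a' b b' c c'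
      = (σ.del nab Θ x a a' b c + U x a a' * Θ x b c) * conj (σ.eps x b' c')
        + (σ.del nab Θ x b b' c a + U x b b' * Θ x c a) * conj (σ.eps x c' a')
        + (σ.del nab Θ x c c' a b + U x c c' * Θ x a b) * conj (σ.eps x a' b') := by
  set T : S x → S x → S x → S x → ℂ :=
    fun a a' b c => σ.del nab Θ x a a' b c + U x a a' * Θ x b c with hT
  have hT₁ (a' b c) : IsSemilinear (RingHom.id ℂ) fun a => T a a' b c :=
    (hΘ.del_isSemilinear₁ a' b c).add_fun ((hU.left x a').mul_const _)
  have hT₂ (a b c) : IsSemilinear (starRingEnd ℂ) fun a' => T a a' b c :=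
    (hΘ.del_isSemilinear₂ a b c).add_fun ((hU.right x a).mul_const _)
  have hT₃ (a a' c) : IsSemilinear (RingHom.id ℂ) fun b => T a a' b c :=
    (h.del_isSemilinear₃ hΘ a a' c).add_fun ((hΘ.left x c).const_mul _)
  have hTc (a a' b c) : T a a' b c = T a a' c b := by
    simp only [hT, hΘ.del_comm_of_symm hΘc a a' b c, hΘc x b c]
  have hT₄ (a a' b) : IsSemilinear (RingHom.id ℂ) (T a a' b) := by
    simpa only [hTc a a' _ b] using hT₃ a a' b
  have hdiv (a c b a') : T a a' b c - T c a' b a = σ.twistedDiv nab U Θ x b a' * σ.eps x c a := by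
    refine (σ.sub_swap_eq_up_mul_eps (B := fun s t => T t a' b s) (fun t => hT₄ t a' b)
      (fun s => hT₁ a' b s) c a).trans ?_
    simp only [RingHom.id_apply, twistedDiv, curlDagger20, up, hT]
    ring
  change _ = T a a' b c * _ + T b b' c a * _ + T c c' a b * _
  rw [hodgeDual, hTc b b' c a]
  linear_combination -conj (σ.eps x b' c') * hdiv a c b a' - conj (σ.eps x c' a') * hdiv b c a b'
    - (hT₂ c a b).schouten (σ := σ) a' b' c' + conj (σ.eps x b' c') * hTc c a' a b

/-- A presentation, near `x`, of the two-form `Θ_{BC} ε̄_{B'C'}` as a finite sum of terms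
`f j • d(p j) ∧ d(q j)`. -/
structure IsGradientWedgeSum (σ : SpinorStructure g S) (Θ : ∀ y : M, S y → S y → ℂ) {J : Type}
    [Fintype J] (f p q : J → M → ℂ) (x : M) : Prop where
  coeff : ∀ᶠ y in nhds x, ∀ j, FunSmoothAt (f j) y
  left : ∀ᶠ y in nhds x, ∀ j, FunSmoothAt (p j) y
  right : ∀ᶠ y in nhds x, ∀ j, FunSmoothAt (q j) y
  eq : ∀ᶠ y in nhds x, ∀ b b' c c', Θ y b c * conj (σ.eps y b' c')
    = ∑ j, f j y * wedge₂ (σ.twist00 (p j) y) (σ.twist00 (q j) y) b b' c c'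

end SpinorStructure

end TwoForm

section DoubleDerivative

variable {M : Type*} [TopologicalSpace M] [ChartedSpace R4 M] [IsManifold (𝓡 4) ∞ M]
  {S : M → Type*} [TopologicalSpace (TotalSpace C2 S)]
  [∀ x, AddCommGroup (S x)] [∀ x, Module ℂ (S x)] [∀ x, TopologicalSpace (S x)]
  [∀ x, IsTopologicalAddGroup (S x)] [∀ x, ContinuousSMul ℝ (S x)]
  [FiberBundle C2 S] [VectorBundle ℝ C2 S]
  {nab : CovariantDerivative (𝓡 4) C2 S} {x : M}

theorem IsSmoothFieldAt.funSmoothAt_wedge₂_parallelExtend {τ : ℂ →+* ℂ}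
    {p q : ∀ y : M, S y → S y → ℂ} (hp : IsSmoothFieldAt τ p x) (hq : IsSmoothFieldAt τ q x)
    (b b' c c' : S x) :
    FunSmoothAt (fun y => wedge₂ (p y) (q y) (parallelExtend nab b y) (parallelExtend nab b' y)
      (parallelExtend nab c y) (parallelExtend nab c' y)) x :=
  .sub ((hp.funSmoothAt_parallelExtend b b').mul (hq.funSmoothAt_parallelExtend c c'))
    ((hq.funSmoothAt_parallelExtend b b').mul (hp.funSmoothAt_parallelExtend c c'))

theorem IsSmoothFieldAt.funSmoothAt_wedge₃_parallelExtend {τ : ℂ →+* ℂ}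
    {P p q : ∀ y : M, S y → S y → ℂ} (hP : IsSmoothFieldAt τ P x) (hp : IsSmoothFieldAt τ p x)
    (hq : IsSmoothFieldAt τ q x) (b b' c c' d d' : S x) :
    FunSmoothAt (fun y => wedge₃ (P y) (p y) (q y)
      (parallelExtend nab b y) (parallelExtend nab b' y) (parallelExtend nab c y)
      (parallelExtend nab c' y) (parallelExtend nab d y) (parallelExtend nab d' y)) x := by
  have hterm (b b' c c' d d') := (hP.funSmoothAt_parallelExtend (nab := nab) b b').mul
    (hp.funSmoothAt_wedge₂_parallelExtend hq (nab := nab) c c' d d')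
  exact ((hterm b b' c c' d d').add (hterm c c' d d' b b')).add
    (hterm d d' b b' c c')

variable [VectorBundle ℂ C2 S] [ContMDiffVectorBundle ∞ C2 S (𝓡 4)]
  {g : LorentzMetric M} {σ : SpinorStructure g S}
  {D : CovariantDerivative (𝓡 4) R4 (TangentSpace (𝓡 4) : M → Type _)}

namespace SpinorStructure

theorem twist00_wedge₂_parallelExtend {τ : ℂ →+* ℂ} {p q : ∀ y : M, S y → S y → ℂ}
    (hp : IsSmoothFieldAt τ p x) (hq : IsSmoothFieldAt τ q x) (a a' b b' c c' : S x) :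
    σ.twist00 (fun y => wedge₂ (p y) (q y) (parallelExtend nab b y) (parallelExtend nab b' y)
        (parallelExtend nab c y) (parallelExtend nab c' y)) x a a'
      = wedge₂ (σ.del nab p x a a') (q x) b b' c c'
        + wedge₂ (p x) (σ.del nab q x a a') b b' c c' := by
  have hp' (s t) := hp.funSmoothAt_parallelExtend (nab := nab) s t
  have hq' (s t) := hq.funSmoothAt_parallelExtend (nab := nab) s t
  simp only [wedge₂]
  rw [σ.twist00_sub ((hp' _ _).mul (hq' _ _)) ((hq' _ _).mul (hp' _ _)),
    σ.twist00_mul (hp' _ _) (hq' _ _), σ.twist00_mul (hq' _ _) (hp' _ _)]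
  simp only [hp.twist00_parallelExtend, hq.twist00_parallelExtend, parallelExtend_self]
  ring

theorem twist00_wedge₃_parallelExtend {τ : ℂ →+* ℂ} {P p q : ∀ y : M, S y → S y → ℂ}
    (hP : IsSmoothFieldAt τ P x) (hp : IsSmoothFieldAt τ p x) (hq : IsSmoothFieldAt τ q x)
    (a a' b b' c c' d d' : S x) :
    σ.twist00 (fun y => wedge₃ (P y) (p y) (q y)
        (parallelExtend nab b y) (parallelExtend nab b' y) (parallelExtend nab c y)
        (parallelExtend nab c' y) (parallelExtend nab d y) (parallelExtend nab d' y)) x a a'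
      = wedge₃ (σ.del nab P x a a') (p x) (q x) b b' c c' d d'
        + wedge₃ (P x) (σ.del nab p x a a') (q x) b b' c c' d d'
        + wedge₃ (P x) (p x) (σ.del nab q x a a') b b' c c' d d' := by
  have hP' (s t) := hP.funSmoothAt_parallelExtend (nab := nab) s t
  have hw (b b' c c') := hp.funSmoothAt_wedge₂_parallelExtend hq (nab := nab) b b' c c'
  have hterm (b b' c c' d d') := (hP' b b').mul (hw c c' d d')
  simp only [wedge₃]
  rw [σ.twist00_add ((hterm _ _ _ _ _ _).add (hterm _ _ _ _ _ _))
      (hterm _ _ _ _ _ _), σ.twist00_add (hterm _ _ _ _ _ _) (hterm _ _ _ _ _ _)]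
  simp only [σ.twist00_mul (hP' _ _) (hw _ _ _ _), hP.twist00_parallelExtend,
    twist00_wedge₂_parallelExtend hp hq, parallelExtend_self]
  ring

theorem twist00_mul_conj_eps_parallelExtend (h : IsSpinConnection σ D nab)
    {Θ : ∀ y : M, S y → S y → ℂ}
    (hΘ : IsSmoothFieldAt (RingHom.id ℂ) Θ x) (a a' b b' c c' : S x) :
    σ.twist00 (fun y => Θ y (parallelExtend nab b y) (parallelExtend nab c y)
        * conj (σ.eps y (parallelExtend nab b' y) (parallelExtend nab c' y))) x a a'
      = σ.del nab Θ x a a' b c * conj (σ.eps x b' c') := by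
  have hε : FunSmoothAt (fun y => σ.eps y (parallelExtend nab b' y) (parallelExtend nab c' y)) x :=
    σ.eps_smooth x _ _ (spinSmoothAt_parallelExtend b') (spinSmoothAt_parallelExtend c')
  rw [σ.twist00_mul (hΘ.funSmoothAt_parallelExtend b c) hε.conj, σ.twist00_conj hε,
    h.twist00_eps_parallelExtend, hΘ.twist00_parallelExtend]
  simp only [parallelExtend_self, map_zero, mul_zero, add_zero]

theorem twist00_hodgeDual (h : IsSpinConnection σ D nab) {β : ∀ y : M, S y → S y → ℂ}
    (hβ : IsSmoothFieldAt (starRingEnd ℂ) β x) (d d' a a' b b' c c' : S x) :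
    σ.twist00 (fun y => σ.hodgeDual y (β y)
        (parallelExtend nab a y) (parallelExtend nab a' y) (parallelExtend nab b y)
        (parallelExtend nab b' y) (parallelExtend nab c y) (parallelExtend nab c' y)) x d d'
      = σ.hodgeDual x (σ.del nab β x d d') a a' b b' c c' := by
  have hε (s t) : FunSmoothAt (fun y => σ.eps y (parallelExtend nab s y) (parallelExtend nab t y))
      x := σ.eps_smooth x _ _ (spinSmoothAt_parallelExtend s) (spinSmoothAt_parallelExtend t)
  have hβ' (s t) := hβ.funSmoothAt_parallelExtend (nab := nab) s t
  have hεε (s t u v) := (hε s t).conj.mul (hε u v)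
  simp only [hodgeDual]
  rw [σ.twist00_add ((hεε _ _ _ _).mul (hβ' _ _)) ((hεε _ _ _ _).mul (hβ' _ _))]
  simp only [σ.twist00_mul (hεε _ _ _ _) (hβ' _ _), σ.twist00_mul (hε _ _).conj (hε _ _),
    σ.twist00_conj (hε _ _), h.twist00_eps_parallelExtend, hβ.twist00_parallelExtend,
    parallelExtend_self, map_zero, zero_mul, mul_zero, zero_add]

theorem hodgeDual_add_mul (β γ : S x → S x → ℂ) (z : ℂ) (a a' b b' c c' : S x) :
    σ.hodgeDual x (fun b b' => β b b' + z * γ b b') a a' b b' c c'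
      = σ.hodgeDual x β a a' b b' c c' + z * σ.hodgeDual x γ a a' b b' c c' := by
  simp only [hodgeDual]
  ring

variable (σ) in
theorem alternate₄_hodgeDual_frame (x : M) (G : S x → S x → S x → S x → ℂ) :
    alternate₄ (fun d d' a a' b b' c c' => σ.hodgeDual x (G d d') a a' b b' c c')
        (σ.frameO x) (σ.frameO x) (σ.frameO x) (σ.frameI x)
        (σ.frameI x) (σ.frameO x) (σ.frameI x) (σ.frameI x)
      = -σ.up x fun b c => σ.up x fun b' c' => G c c' b b' := by
  simp only [alternate₄, hodgeDual, up, σ.eps_swap x (σ.frameO x) (σ.frameI x), σ.eps_frame,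
    σ.eps_alt, map_one, map_neg, map_zero]
  ring

namespace IsGradientWedgeSum

variable {Θ U : ∀ y : M, S y → S y → ℂ} {J : Type} [Fintype J] {f p q : J → M → ℂ}

protected theorem eventually (hΘ : σ.IsGradientWedgeSum Θ f p q x) :
    ∀ᶠ y in nhds x, σ.IsGradientWedgeSum Θ f p q y := by
  filter_upwards [hΘ.coeff.eventually_nhds, hΘ.left.eventually_nhds, hΘ.right.eventually_nhds,
    hΘ.eq.eventually_nhds] with y hf hp hq heq
  exact ⟨hf, hp, hq, heq⟩

theorem del_mul_conj_eps (hΘ : σ.IsGradientWedgeSum Θ f p q x) (h : IsSpinConnection σ D nab)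
    (hΘs : IsSmoothFieldAt (RingHom.id ℂ) Θ x) (a a' b b' c c' : S x) :
    σ.del nab Θ x a a' b c * conj (σ.eps x b' c')
      = ∑ j, (σ.twist00 (f j) x a a' * wedge₂ (σ.twist00 (p j) x) (σ.twist00 (q j) x) b b' c c'
        + f j x * (wedge₂ (σ.del nab (σ.twist00 (p j)) x a a') (σ.twist00 (q j) x) b b' c c'
          + wedge₂ (σ.twist00 (p j) x) (σ.del nab (σ.twist00 (q j)) x a a') b b' c c')) := by
  have hf := hΘ.coeff.self_of_nhds
  have hp (j) := σ.isSmoothFieldAt_twist00 (hΘ.left.self_of_nhds j)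
  have hq (j) := σ.isSmoothFieldAt_twist00 (hΘ.right.self_of_nhds j)
  have hw (j) := (hp j).funSmoothAt_wedge₂_parallelExtend (hq j) (nab := nab) b b' c c'
  rw [← twist00_mul_conj_eps_parallelExtend h hΘs,
    σ.twist00_congr (hΘ.eq.mono fun y hy => hy (parallelExtend nab b y) (parallelExtend nab b' y)
      (parallelExtend nab c y) (parallelExtend nab c' y)),
    σ.twist00_sum fun j _ => (hf j).mul (hw j)]
  simp only [σ.twist00_mul (hf _) (hw _), twist00_wedge₂_parallelExtend (hp _) (hq _),
    parallelExtend_self]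

theorem hodgeDual_twistedDiv (hΘ : σ.IsGradientWedgeSum Θ f p q x) (h : IsSpinConnection σ D nab)
    (hD : D.torsion = 0) (hΘs : IsSmoothFieldAt (RingHom.id ℂ) Θ x)
    (hΘc : ∀ y a b, Θ y a b = Θ y b a) (hU : IsSmoothFieldAt (starRingEnd ℂ) U x)
    (a a' b b' c c' : S x) :
    σ.hodgeDual x (σ.twistedDiv nab U Θ x) a a' b b' c c'
      = ∑ j, wedge₃ (σ.twistedGrad 1 U (f j) x) (σ.twist00 (p j) x) (σ.twist00 (q j) x)
        a a' b b' c c' := by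
  have hp (j) := h.del_twist00_symm hD (hΘ.left.self_of_nhds j)
  have hq (j) := h.del_twist00_symm hD (hΘ.right.self_of_nhds j)
  have heq := hΘ.eq.self_of_nhds
  rw [SpinorStructure.hodgeDual_twistedDiv h hΘs hΘc hU]
  simp only [add_mul, mul_assoc, heq, hΘ.del_mul_conj_eps h hΘs, Finset.mul_sum,
    ← Finset.sum_add_distrib]
  refine Finset.sum_congr rfl fun j _ => ?_
  simp only [wedge₃, wedge₂, twistedGrad]
  rw [hp j b b' a a', hp j c c' a a', hp j c c' b b', hq j b b' a a', hq j c c' a a',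
    hq j c c' b b']
  ring

theorem del_hodgeDual_twistedDiv (hΘ : σ.IsGradientWedgeSum Θ f p q x)
    (h : IsSpinConnection σ D nab) (hD : D.torsion = 0)
    (hΘs : ∀ y, IsSmoothFieldAt (RingHom.id ℂ) Θ y) (hΘc : ∀ y a b, Θ y a b = Θ y b a)
    (hU : ∀ᶠ y in nhds x, IsSmoothFieldAt (starRingEnd ℂ) U y)
    (hβ : IsSmoothFieldAt (starRingEnd ℂ) (σ.twistedDiv nab U Θ) x) (d d' a a' b b' c c' : S x) :
    σ.hodgeDual x (σ.del nab (σ.twistedDiv nab U Θ) x d d') a a' b b' c c'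
      = ∑ j, (wedge₃ (σ.del nab (σ.twistedGrad 1 U (f j)) x d d') (σ.twist00 (p j) x)
          (σ.twist00 (q j) x) a a' b b' c c'
        + wedge₃ (σ.twistedGrad 1 U (f j) x) (σ.del nab (σ.twist00 (p j)) x d d')
          (σ.twist00 (q j) x) a a' b b' c c'
        + wedge₃ (σ.twistedGrad 1 U (f j) x) (σ.twist00 (p j) x)
          (σ.del nab (σ.twist00 (q j)) x d d') a a' b b' c c') := by
  have hP (j) := σ.isSmoothFieldAt_twistedGrad 1 hU.self_of_nhds (hΘ.coeff.self_of_nhds j)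
  have hp (j) := σ.isSmoothFieldAt_twist00 (hΘ.left.self_of_nhds j)
  have hq (j) := σ.isSmoothFieldAt_twist00 (hΘ.right.self_of_nhds j)
  have hdual : ∀ᶠ y in nhds x, ∀ a a' b b' c c' : S y,
      σ.hodgeDual y (σ.twistedDiv nab U Θ y) a a' b b' c c'
        = ∑ j, wedge₃ (σ.twistedGrad 1 U (f j) y) (σ.twist00 (p j) y) (σ.twist00 (q j) y)
          a a' b b' c c' := by
    filter_upwards [hΘ.eventually, hU] with y hy hUy
    exact hy.hodgeDual_twistedDiv h hD (hΘs y) hΘc hUy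
  rw [← twist00_hodgeDual h hβ, σ.twist00_congr (hdual.mono fun y hy => hy _ _ _ _ _ _),
    σ.twist00_sum fun j _ => (hP j).funSmoothAt_wedge₃_parallelExtend (hp j) (hq j) ..]
  simp only [twist00_wedge₃_parallelExtend (hP _) (hp _) (hq _)]

theorem div11_twistedDiv (hΘ : σ.IsGradientWedgeSum Θ f p q x)
    (h : IsSpinConnection σ D nab) (hD : D.torsion = 0)
    (hΘs : ∀ y, IsSmoothFieldAt (RingHom.id ℂ) Θ y) (hΘc : ∀ y a b, Θ y a b = Θ y b a)
    (hU : ∀ᶠ y in nhds x, IsSmoothFieldAt (starRingEnd ℂ) U y)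
    (hUc : ∀ a a' b b', σ.del nab U x a a' b b' = σ.del nab U x b b' a a')
    (hβ : IsSmoothFieldAt (starRingEnd ℂ) (σ.twistedDiv nab U Θ) x) :
    σ.div11 nab (σ.twistedDiv nab U Θ) x
      = -σ.up x fun a b => σ.up x fun a' b' => U x b b' * σ.twistedDiv nab U Θ x a a' := by
  have hf := hΘ.coeff.self_of_nhds
  have hp (j) := h.del_twist00_symm hD (hΘ.left.self_of_nhds j)
  have hq (j) := h.del_twist00_symm hD (hΘ.right.self_of_nhds j)
  have hP (j) (a a' b b') :=
    (σ.del_twistedGrad_sub_swap h hD hU.self_of_nhds hUc (hf j) 1 a a' b b').trans (one_mul _)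
  have hclosed : σ.up x (fun b c => σ.up x fun b' c' =>
      σ.del nab (σ.twistedDiv nab U Θ) x c c' b b'
        + U x c c' * σ.twistedDiv nab U Θ x b b') = 0 := by
    rw [← neg_eq_zero, ← σ.alternate₄_hodgeDual_frame x fun d d' b b' =>
      σ.del nab (σ.twistedDiv nab U Θ) x d d' b b' + U x d d' * σ.twistedDiv nab U Θ x b b']
    simp only [hodgeDual_add_mul, hΘ.del_hodgeDual_twistedDiv h hD hΘs hΘc hU hβ,
      hΘ.hodgeDual_twistedDiv h hD (hΘs x) hΘc hU.self_of_nhds, Finset.mul_sum,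
      ← Finset.sum_add_distrib, alternate₄_sum]
    exact Finset.sum_eq_zero fun j _ => alternate₄_wedge₃_eq_zero (hP j) (hp j) (hq j) ..
  simp only [div11, up] at hclosed ⊢
  linear_combination hclosed

end IsGradientWedgeSum

end SpinorStructure

end DoubleDerivative

section Coordinates

variable {M : Type*} [TopologicalSpace M] [ChartedSpace R4 M] [IsManifold (𝓡 4) ∞ M] {x y : M}

/-- The `j`-th coordinate vector field of the preferred chart at `x`. -/
def coordField (x : M) (j : Fin 4) (y : M) : TangentSpace (𝓡 4) y :=
  (trivializationAt R4 (TangentSpace (𝓡 4) : M → Type _) x).symm y (EuclideanSpace.single j 1)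

theorem eventually_vecSmoothAt_coordField (x : M) (j : Fin 4) :
    ∀ᶠ y in nhds x, VecSmoothAt (coordField x j) y := by
  set t := trivializationAt R4 (TangentSpace (𝓡 4) : M → Type _) x with ht
  obtain ⟨s, hs, hsmooth⟩ := exists_contMDiffOn_extend (k := ∞) (𝓡 4) R4
    (t.symm x (EuclideanSpace.single j 1))
  filter_upwards [eventually_mem_nhds_iff.2 hs] with y hy
  have hextend := hsmooth.contMDiffAt hy
  simp only [extend, ← ht, t.apply_mk_symm (mem_baseSet_trivializationAt' x)] at hextend
  exact hextend

theorem eq_sum_coordField (hy : y ∈ (chartAt R4 x).source) (v : TangentSpace (𝓡 4) y) :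
    v = ∑ j, mvfderiv (𝓡 4) (chartCoord x j) y v • coordField x j y := by
  set t := trivializationAt R4 (TangentSpace (𝓡 4) : M → Type _) x
  have hyt : y ∈ t.baseSet := hy
  have hderiv : t.continuousLinearMapAt ℝ y v = mfderiv (𝓡 4) 𝓘(ℝ, R4) (extChartAt (𝓡 4) x) y v :=
    congrArg (fun l => l v) (TangentBundle.continuousLinearMapAt_trivializationAt (I := 𝓡 4) hy)
  have hv : t.symmL ℝ y (t.continuousLinearMapAt ℝ y v) = v :=
    t.symmL_continuousLinearMapAt hyt v
  have hsum := linearMap_apply_eq_sum_single (t.symmL ℝ y).toLinearMap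
    (t.continuousLinearMapAt ℝ y v)
  refine hv.symm.trans (hsum.trans (Finset.sum_congr rfl fun j _ => ?_))
  rw [mvfderiv_chartCoord hy, ← hderiv]
  exact congrArg _ (t.symmL_apply hyt _)

end Coordinates

section Decomposition

variable {M : Type*} [TopologicalSpace M] [ChartedSpace R4 M] [IsManifold (𝓡 4) ∞ M]
  {S : M → Type*} [TopologicalSpace (TotalSpace C2 S)]
  [∀ x, AddCommGroup (S x)] [∀ x, Module ℂ (S x)] [∀ x, TopologicalSpace (S x)]
  [∀ x, IsTopologicalAddGroup (S x)] [∀ x, ContinuousSMul ℝ (S x)]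
  [FiberBundle C2 S] [VectorBundle ℂ C2 S] [VectorBundle ℝ C2 S]
  [ContMDiffVectorBundle ∞ C2 S (𝓡 4)]
  {g : LorentzMetric M} {σ : SpinorStructure g S} {x y : M} {τ : ℂ →+* ℂ}

theorem IsSemilinear.up_mul_eps {h : S x → ℂ} (hh : IsSemilinear τ h) (v : S x) :
    σ.up x (fun s t => h s * τ (σ.eps x v t)) = h v := by
  rw [SpinorStructure.up, hh.eq_frame (σ.eps_frame x) v, σ.eps_swap x v, map_neg]
  ring

theorem IsSmoothFieldAt.contract_of_conj {φ ψ : ∀ y : M, S y → S y → ℂ}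
    (hφ : IsSmoothFieldAt (starRingEnd ℂ) φ x) (hψ : IsSmoothFieldAt (starRingEnd ℂ) ψ x) :
    IsSmoothFieldAt (RingHom.id ℂ) (σ.contract φ ψ) x where
  real _ := rfl
  left y b := .of_smul_add fun z s t => by
    simp only [SpinorStructure.contract, SpinorStructure.up, (hφ.left y _).add, (hφ.left y _).smul]
    ring
  right y a := .of_smul_add fun z s t => by
    simp only [SpinorStructure.contract, SpinorStructure.up, (hψ.left y _).add, (hψ.left y _).smul]
    ring
  smooth s t hs ht := by
    have hconj : IsSmoothFieldAt (RingHom.id ℂ)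
        (fun y d f => conj (φ y (s y) d) * conj (ψ y (t y) f)) x :=
      { real _ := rfl
        left y f := IsSemilinear.mul_const ⟨fun d d' => by rw [(hφ.right y _).add, map_add],
          fun z d => by rw [(hφ.right y _).smul, map_mul, Complex.conj_conj, RingHom.id_apply]⟩ _
        right y d := IsSemilinear.const_mul ⟨fun f f' => by rw [(hψ.right y _).add, map_add],
          fun z f => by rw [(hψ.right y _).smul, map_mul, Complex.conj_conj, RingHom.id_apply]⟩ _
        smooth u v hu hv := (hφ.smooth s u hs hu).conj.mul (hψ.smooth t v ht hv).conj }
    simpa only [SpinorStructure.contract, SpinorStructure.up, map_sub, map_mul, Complex.conj_conj]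
      using (hconj.funSmoothAt_up (σ := σ)).conj

namespace SpinorStructure

theorem twist00_chartCoord (hy : y ∈ (chartAt R4 x).source) (j : Fin 4) (b b' : S y) :
    σ.twist00 (fun y => (chartCoord x j y : ℂ)) y b b'
      = spinorForm (fun s t => σ.vecRe y s t)
        (fun v => (mvfderiv (𝓡 4) (chartCoord x j) y v : ℂ)) b b' := by
  have hcoord : MDifferentiableAt (𝓡 4) 𝓘(ℝ, ℝ) (chartCoord x j) y :=
    (contMDiffAt_chartCoord hy j).mdifferentiableAt (by simp)
  have hderiv (v : TangentSpace (𝓡 4) y) := mvfderiv_comp_differentiableAt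
    (L := Complex.ofRealCLM) Complex.ofRealCLM.differentiableAt hcoord v
  simp only [ContinuousLinearMap.fderiv, Complex.ofRealCLM_apply] at hderiv
  simp only [twist00, hderiv]

variable (σ) in
/-- The metric dual of the `j`-th coordinate vector field of the preferred chart at `x`, as a
field with one unprimed and one primed index. -/
def coordDual (x : M) (j : Fin 4) (y : M) (s s' : S y) : ℂ :=
  spinorForm (fun s t => σ.vecRe y s t) (fun v => (g.val y (coordField x j y) v : ℂ)) s s'

theorem isSmoothFieldAt_coordDual {j : Fin 4} (hj : VecSmoothAt (coordField x j) y) :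
    IsSmoothFieldAt (starRingEnd ℂ) (σ.coordDual x j) y where
  real := Complex.conj_ofReal
  left y := spinorForm_isSemilinear_left (σ.vecRe y)
    (Complex.ofRealCLM.toLinearMap ∘ₗ g.val y (coordField x j y))
  right y := spinorForm_isSemilinear_right (σ.vecRe y)
    (Complex.ofRealCLM.toLinearMap ∘ₗ g.val y (coordField x j y)) (σ.vecRe_I y)
  smooth s t hs ht := by
    have hre (u) (hu : SpinSmoothAt u y) := FunSmoothAt.ofReal
      (g.smooth y _ _ hj (σ.vecRe_smooth y u t hu ht))
    exact .sub (hre s hs) (.mul contMDiffAt_const (hre _ hs.smul_I))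

theorem sum_twist00_chartCoord_mul_coordDual (hy : y ∈ (chartAt R4 x).source) (b b' s s' : S y) :
    ∑ j, σ.twist00 (fun y => (chartCoord x j y : ℂ)) y b b' * σ.coordDual x j y s s'
      = σ.eps y b s * conj (σ.eps y b' s') := by
  have hlower (v : TangentSpace (𝓡 4) y) :
      spinorForm (fun s t => σ.vecRe y s t) (fun w => (g.val y v w : ℂ)) s s'
        = ∑ j, mvfderiv (𝓡 4) (chartCoord x j) y v * σ.coordDual x j y s s' := by
    conv_lhs => rw [eq_sum_coordField hy v]
    simp only [coordDual, spinorForm, map_sum, LinearMap.sum_apply, map_smul, LinearMap.smul_apply,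
      smul_eq_mul, Complex.ofReal_sum, Complex.ofReal_mul, Finset.mul_sum,
      ← Finset.sum_sub_distrib]
    exact Finset.sum_congr rfl fun j _ => by ring
  rw [← σ.metric_eq y b b' s s']
  simp only [hlower, twist00_chartCoord hy]
  simp only [spinorForm, Finset.mul_sum, ← Finset.sum_sub_distrib]
  exact Finset.sum_congr rfl fun j _ => by ring

theorem mul_conj_eps_eq_sum {J : Type} [Fintype J] {Θ : ∀ y : M, S y → S y → ℂ}
    {p : J → S y → S y → ℂ} {A : J → ∀ y : M, S y → S y → ℂ}
    (hl : ∀ t, IsSemilinear (RingHom.id ℂ) fun s => Θ y s t)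
    (hr : ∀ s, IsSemilinear (RingHom.id ℂ) (Θ y s))
    (hA : ∀ b b' s s', ∑ j, p j b b' * A j y s s' = σ.eps y b s * conj (σ.eps y b' s'))
    (b b' c c' : S y) :
    Θ y b c * conj (σ.eps y b' c')
      = ∑ j : J × J, σ.inner20 Θ (σ.contract (A j.1) (A j.2)) y * (p j.1 b b' * p j.2 c c') := by
  have hε : IsSemilinear (starRingEnd ℂ) fun s => conj (σ.eps y b' s) :=
    ⟨fun s t => by rw [map_add, map_add], fun z s => by rw [map_smul, smul_eq_mul, map_mul]⟩
  have hcontract (s t : S y) :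
      ∑ j : J × J, σ.contract (A j.1) (A j.2) y s t * (p j.1 b b' * p j.2 c c')
        = σ.eps y b s * σ.eps y c t * conj (σ.eps y b' c') := by
    calc _ = σ.up y fun s' t' => (∑ j, p j b b' * A j y s s') * ∑ k, p k c c' * A k y t t' := by
          simp only [contract, up, Finset.sum_mul_sum, Fintype.sum_prod_type,
            ← Finset.sum_sub_distrib]
          exact Finset.sum_congr rfl fun j _ => Finset.sum_congr rfl fun k _ => by ring
      _ = σ.eps y b s * σ.eps y c t
          * σ.up y fun s' t' => conj (σ.eps y b' s') * conj (σ.eps y c' t') := by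
          simp only [hA, up]
          ring
      _ = _ := by rw [hε.up_mul_eps]
  calc _ = σ.up y fun s u => Θ y s c * σ.eps y b u * conj (σ.eps y b' c') := by
        rw [← (hl c).up_mul_eps (σ := σ) b]
        simp only [up, RingHom.id_apply]
        ring
    _ = σ.up y fun s u => σ.up y fun d f =>
          Θ y s d * (σ.eps y b u * σ.eps y c f * conj (σ.eps y b' c')) := by
        congr 1
        funext s u
        rw [← (hr s).up_mul_eps (σ := σ) c]
        simp only [up, RingHom.id_apply]
        ring
    _ = _ := by
        simp only [← hcontract, inner20, up, Finset.mul_sum,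
          ← Finset.sum_sub_distrib]
        exact Finset.sum_congr rfl fun j _ => by ring

theorem exists_isGradientWedgeSum {Θ : ∀ y : M, S y → S y → ℂ}
    (hΘ : ∀ y, IsSmoothFieldAt (RingHom.id ℂ) Θ y) (hΘc : ∀ y a b, Θ y a b = Θ y b a) (x : M) :
    ∃ f p q : Fin 4 × Fin 4 → M → ℂ, σ.IsGradientWedgeSum Θ f p q x := by
  have hsource := (chartAt R4 x).open_source.mem_nhds (mem_chart_source R4 x)
  have hX (y) (hy : y ∈ (chartAt R4 x).source) (j) :=
    FunSmoothAt.ofReal (contMDiffAt_chartCoord hy j)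
  refine ⟨fun j y => 1 / 2 * σ.inner20 Θ (σ.contract (σ.coordDual x j.1) (σ.coordDual x j.2)) y,
    fun j y => chartCoord x j.1 y, fun j y => chartCoord x j.2 y, ?_, ?_, ?_, ?_⟩
  · filter_upwards [Filter.eventually_all.2 (eventually_vecSmoothAt_coordField x)] with y hy j
    have hA (k) := isSmoothFieldAt_coordDual (σ := σ) (hy k)
    exact .mul contMDiffAt_const ((hΘ y).funSmoothAt_inner20 ((hA j.1).contract_of_conj (hA j.2)))
  · filter_upwards [hsource] with y hy j using hX y hy j.1
  · filter_upwards [hsource] with y hy j using hX y hy j.2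
  · filter_upwards [hsource] with y hy b b' c c'
    have hsum := mul_conj_eps_eq_sum (σ := σ) ((hΘ y).left y) ((hΘ y).right y)
      (sum_twist00_chartCoord_mul_coordDual hy)
    calc Θ y b c * conj (σ.eps y b' c')
        = 1 / 2 * (Θ y b c * conj (σ.eps y b' c') - Θ y c b * conj (σ.eps y c' b')) := by
          rw [hΘc y c b, σ.eps_swap y b' c', map_neg]
          ring
      _ = _ := by
          rw [hsum b b' c c', hsum c c' b b', ← Finset.sum_sub_distrib, Finset.mul_sum]
          exact Finset.sum_congr rfl fun j _ => by
            rw [wedge₂]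
            ring

end SpinorStructure

end Decomposition

end KillingSpinorMaxwell

end

theorem mainTheorem6 {M : Type*} [TopologicalSpace M] [ChartedSpace KillingSpinorMaxwell.R4 M]
    [IsManifold (𝓡 4) ∞ M]
    {S : M → Type*} [TopologicalSpace (TotalSpace KillingSpinorMaxwell.C2 S)]
    [∀ x, AddCommGroup (S x)] [∀ x, Module ℂ (S x)] [∀ x, TopologicalSpace (S x)]
    [∀ x, IsTopologicalAddGroup (S x)] [∀ x, ContinuousSMul ℝ (S x)]
    [FiberBundle KillingSpinorMaxwell.C2 S] [VectorBundle ℂ KillingSpinorMaxwell.C2 S]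
    [VectorBundle ℝ KillingSpinorMaxwell.C2 S]
    [ContMDiffVectorBundle ∞ KillingSpinorMaxwell.C2 S (𝓡 4)]
    (g : KillingSpinorMaxwell.LorentzMetric M)
    (σ : KillingSpinorMaxwell.SpinorStructure g S)
    (D : CovariantDerivative (𝓡 4) KillingSpinorMaxwell.R4 (TangentSpace (𝓡 4) : M → Type _))
    (hD : KillingSpinorMaxwell.IsLeviCivita g D)
    (nab : CovariantDerivative (𝓡 4) KillingSpinorMaxwell.C2 S)
    (hnab : KillingSpinorMaxwell.IsSpinConnection σ D nab)
    (κ φ : KillingSpinorMaxwell.SymSpinor S)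
    (hκ : σ.IsKillingSpinor nab κ)
    (hκ0 : ∀ x, σ.inner20 κ.comp κ.comp x ≠ 0)
    (hφ : σ.IsMaxwell nab φ) :
    (∀ (x : M) (a a' : S x),
      σ.beta nab κ φ x a a'
        = -σ.U κ x a a' * σ.Upsilon κ φ x + σ.twist00 (σ.Upsilon κ φ) x a a') ∧
    (∀ x : M,
      σ.div11 nab (σ.beta nab κ φ) x
        = -σ.up x fun a b => σ.up x fun a' b' => σ.U κ x b b' * σ.beta nab κ φ x a a') ∧
    (∀ (x : M) (a b : S x),
      σ.curl11 nab (σ.beta nab κ φ) x a b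
        = (1 / 2) * ((σ.up x fun a' b' => σ.U κ x a b' * σ.beta nab κ φ x b a')
          + σ.up x fun a' b' => σ.U κ x b b' * σ.beta nab κ φ x a a')) ∧
    (∀ (x : M) (a' b' : S x),
      σ.curlDagger11 nab (σ.beta nab κ φ) x a' b'
        = (1 / 2) * ((σ.up x fun a b => σ.U κ x b a' * σ.beta nab κ φ x a b')
          + σ.up x fun a b => σ.U κ x b b' * σ.beta nab κ φ x a a')) := by
  have hgrad : σ.beta nab κ φ = σ.twistedGrad (-1) (σ.U κ) (σ.Upsilon κ φ) := by
    funext x a a'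
    exact σ.twistedDiv_Theta hnab hκ (hκ0 x) hφ a a'
  have hU (x) := σ.isSmoothFieldAt_U (hκ0 x)
  have hUc (x) := σ.del_U_symm hnab hD.torsion_free (hκ0 x)
  have hΘ (x) := σ.isSmoothFieldAt_Theta κ φ x
  have hΥ (x) : KillingSpinorMaxwell.FunSmoothAt (σ.Upsilon κ φ) x :=
    (φ.isSmoothFieldAt_comp x).funSmoothAt_inner20 (κ.isSmoothFieldAt_comp x)
  have hβ (x) : KillingSpinorMaxwell.IsSmoothFieldAt (starRingEnd ℂ) (σ.beta nab κ φ) x :=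
    hgrad ▸ σ.isSmoothFieldAt_twistedGrad (-1) (hU x) (hΥ x)
  have hβ_swap (x) :=
    hgrad ▸ σ.del_twistedGrad_sub_swap hnab hD.torsion_free (hU x) (hUc x) (hΥ x) (-1)
  refine ⟨fun x a a' => ?_, fun x => ?_, fun x => σ.curl11_eq_of_sub_swap (hβ_swap x),
    fun x => σ.curlDagger11_eq_of_sub_swap (hβ_swap x)⟩
  · rw [hgrad, KillingSpinorMaxwell.SpinorStructure.twistedGrad]
    ring
  · obtain ⟨f, p, q, hsum⟩ := σ.exists_isGradientWedgeSum hΘ (σ.Theta_comm κ φ) x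
    exact hsum.div11_twistedDiv hnab hD.torsion_free hΘ (σ.Theta_comm κ φ) (.of_forall hU)
      (hUc x) (hβ x)
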